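/- Conventions. For an affine group scheme $F$ over a commutative ring $R$ with coordinate ring $R[F]$, an $F$-algebra is a commutative $R$-algebra $S$ with an action of $F$, i.e. with a coassociative, counital $R$-algebra homomorphism $\omega\colon S\to S\otimes_R R[F]$. An ideal $I$ of $S$ is an $F$-ideal (is $F$-stable) if $\omega(I)$ is contained in the image of $I\otimes_R R[F]$ in $S\otimes_R R[F]$. An $F$-ideal $P\neq S$ is $F$-prime if for all $F$-ideals $I,J$ of $S$, $IJ\subseteq P$ implies $I\subseteq P$ or $J\subseteq P$; $S$ is an $F$-domain if its zero ideal is $F$-prime. The ring of invariants is $S^F=\{s\in S\mid \omega(s)=s\otimes 1\}$. The height of an ideal is the infimum of the heights of its minimal primes. Exactness of a sequence of group schemes is exactness as fppf sheaves. (1) Lemma. Let $R$ be a Noetherian commutative ring, and let $$1\to N\to F\to T\to 1$$ be an exact sequence of affine $R$-group schemes that are flat and of finite type over $R$, where $T\cong\mathbb G_m^n$ is a split torus ($n\ge 0$). Let $S$ be an $F$-algebra which is a Noetherian ring and an $F$-domain. Assume that for every $F$-prime $F$-ideal $P$ of $S$ of height one such that $P\cap S^N$ is a minimal prime of some nonzero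 principal ideal of $S^N$, the ideal $P\cap S^N$ of $S^N$ is principal. Then $S^N$ is a UFD (in particular an integral domain). (2) Corollary. Let $k$ be a field and $G$ a connected smooth affine algebraic group over $k$. Let $S$ be a $G$-algebra which is a Noetherian integral domain, and let $S_G$ be the $k$-subalgebra of $S$ generated by the semiinvariants, i.e. by the elements $f\in S$ with $\omega(f)=f\otimes\chi$ for some character (group-like element) $\chi\in k[G]$. Assume that for every $G$-stable prime ideal $P$ of $S$ of height one such that $P\cap S_G$ is a minimal prime of some nonzero principal ideal of $S_G$, the ideal $P\cap S_G$ of $S_G$ is principal. Then $S_G$ is a UFD (in particular an integral domain). -/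

import Mathlib

open scoped TensorProduct

universe u v

/-! Affine group schemes over `R` are given by their commutative Hopf algebras: `H` is the
coordinate ring `R[F]` of `F`, an `R`-algebra homomorphism `H → B` is a `B`-valued point of `F`,
and a homomorphism of group schemes is a bialgebra homomorphism in the other direction. -/

/-- An action of the affine `R`-group scheme `F = Spec H` on the commutative `R`-algebra `S`,
making `S` an `F`-algebra: a coaction `ω : S → S ⊗ R[F]` that is a homomorphism of `R`-algebras,
coassociative and counital. -/
structure GroupSchemeAction (R : Type*) [CommRing R] (H : Type*) [CommRing H] [HopfAlgebra R H]
    (S : Type*) [CommRing S] [Algebra R S] where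
  coaction : S →ₐ[R] S ⊗[R] H
  coassoc : ((Algebra.TensorProduct.assoc R R R S H H).toAlgHom.comp
      (Algebra.TensorProduct.map coaction (AlgHom.id R H))).comp coaction =
    (Algebra.TensorProduct.map (AlgHom.id R S) (Bialgebra.comulAlgHom R H)).comp coaction
  counit : (Algebra.TensorProduct.map (AlgHom.id R S) (Bialgebra.counitAlgHom R H)).comp coaction =
    Algebra.TensorProduct.includeLeft

namespace GroupSchemeAction

section

variable {R : Type*} [CommRing R] {H : Type*} [CommRing H] [HopfAlgebra R H]
  {S : Type*} [CommRing S] [Algebra R S]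

/-- The restriction of an action of `Spec H` along a homomorphism `Spec H' → Spec H` of
group schemes. -/
def restrict {H' : Type*} [CommRing H'] [HopfAlgebra R H']
    (act : GroupSchemeAction R H S) (φ : H →ₐc[R] H') : GroupSchemeAction R H' S where
  coaction := (Algebra.TensorProduct.map (AlgHom.id R S) (φ : H →ₐ[R] H')).comp act.coaction
  coassoc := by
    have hcomul : (Bialgebra.comulAlgHom R H').comp (φ : H →ₐ[R] H') =
        (Algebra.TensorProduct.map (φ : H →ₐ[R] H') (φ : H →ₐ[R] H')).comp
          (Bialgebra.comulAlgHom R H) :=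
      (BialgHomClass.map_comp_comulAlgHom φ).symm
    have h := congrArg (fun f ↦ (Algebra.TensorProduct.map (AlgHom.id R S)
      (Algebra.TensorProduct.map (φ : H →ₐ[R] H') (φ : H →ₐ[R] H'))).comp f) act.coassoc
    have hl : ((Algebra.TensorProduct.assoc R R R S H' H').toAlgHom.comp
        (Algebra.TensorProduct.map
          ((Algebra.TensorProduct.map (AlgHom.id R S) (φ : H →ₐ[R] H')).comp act.coaction)
          (AlgHom.id R H'))).comp
        (Algebra.TensorProduct.map (AlgHom.id R S) (φ : H →ₐ[R] H')) =
      (Algebra.TensorProduct.map (AlgHom.id R S)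
        (Algebra.TensorProduct.map (φ : H →ₐ[R] H') (φ : H →ₐ[R] H'))).comp
        ((Algebra.TensorProduct.assoc R R R S H H).toAlgHom.comp
          (Algebra.TensorProduct.map act.coaction (AlgHom.id R H))) := by
      have key : ((Algebra.TensorProduct.assoc R R R S H' H').toAlgHom.comp
          (Algebra.TensorProduct.map
            (Algebra.TensorProduct.map (AlgHom.id R S) (φ : H →ₐ[R] H')) (φ : H →ₐ[R] H'))) =
          (Algebra.TensorProduct.map (AlgHom.id R S)
            (Algebra.TensorProduct.map (φ : H →ₐ[R] H') (φ : H →ₐ[R] H'))).comp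
            (Algebra.TensorProduct.assoc R R R S H H).toAlgHom := by
        ext <;> simp [Algebra.TensorProduct.one_def]
      rw [← AlgHom.comp_assoc, ← key, AlgHom.comp_assoc, AlgHom.comp_assoc]
      rw [← Algebra.TensorProduct.map_comp, ← Algebra.TensorProduct.map_comp]
      simp
    have hr : (Algebra.TensorProduct.map (AlgHom.id R S) (Bialgebra.comulAlgHom R H')).comp
        (Algebra.TensorProduct.map (AlgHom.id R S) (φ : H →ₐ[R] H')) =
      (Algebra.TensorProduct.map (AlgHom.id R S)
        (Algebra.TensorProduct.map (φ : H →ₐ[R] H') (φ : H →ₐ[R] H'))).comp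
        (Algebra.TensorProduct.map (AlgHom.id R S) (Bialgebra.comulAlgHom R H)) := by
      rw [← Algebra.TensorProduct.map_comp, ← Algebra.TensorProduct.map_comp, hcomul]
    exact (congrArg (fun f ↦ f.comp act.coaction) hl).trans
      (h.trans (congrArg (fun f ↦ f.comp act.coaction) hr).symm)
  counit := by
    rw [← act.counit, ← AlgHom.comp_assoc, ← Algebra.TensorProduct.map_comp]
    congr 2
    exact BialgHomClass.counitAlgHom_comp φ

/-- The subalgebra `S^F` of invariants: the elements `s` with `ω(s) = s ⊗ 1`. -/
def invariants (act : GroupSchemeAction R H S) : Subalgebra R S :=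
  AlgHom.equalizer act.coaction Algebra.TensorProduct.includeLeft

/-- `I` is an `F`-ideal (an `F`-stable ideal): `ω(I)` lies in the image of `I ⊗ R[F]` in
`S ⊗ R[F]`, which is the ideal of `S ⊗ R[F]` generated by the elements `a ⊗ 1` with `a ∈ I`. -/
def IsStable (act : GroupSchemeAction R H S) (I : Ideal S) : Prop :=
  ∀ a ∈ I, act.coaction a ∈
    I.map (Algebra.TensorProduct.includeLeft : S →ₐ[R] S ⊗[R] H)

/-- `P` is an `F`-prime `F`-ideal: a proper `F`-ideal such that `I * J ≤ P` implies `I ≤ P` or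
`J ≤ P` for all `F`-ideals `I` and `J`. -/
structure IsFPrime (act : GroupSchemeAction R H S) (P : Ideal S) : Prop where
  stable : act.IsStable P
  ne_top : P ≠ ⊤
  le_or_le : ∀ I J : Ideal S, act.IsStable I → act.IsStable J → I * J ≤ P → I ≤ P ∨ J ≤ P

/-- `S` is an `F`-domain (`Spec S` is `F`-integral): the zero ideal is `F`-prime. -/
def IsFDomain (act : GroupSchemeAction R H S) : Prop :=
  act.IsFPrime ⊥

/-- `f` is a semiinvariant: `ω(f) = f ⊗ χ` for some character `χ`, the characters being the
group-like elements of the coordinate ring. -/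
def IsSemiinvariant (act : GroupSchemeAction R H S) (f : S) : Prop :=
  ∃ χ : H, IsGroupLikeElem R χ ∧ act.coaction f = f ⊗ₜ[R] χ

/-- `S_F`, the subalgebra of `S` generated by the semiinvariants. -/
def semiinvariants (act : GroupSchemeAction R H S) : Subalgebra R S :=
  Algebra.adjoin R {f | act.IsSemiinvariant f}

end

end GroupSchemeAction

/-- The sequence `1 → N → F → T → 1` of affine `R`-group schemes, with `N = Spec HN`,
`F = Spec HF`, `T = Spec HT`, is exact as a sequence of fppf sheaves: `N → F` is injective on
points, its image is the kernel of `F → T`, and every point of `T` lifts to `F` after a faithfully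
flat and finitely presented extension. -/
structure IsShortExactGroupSchemes {R : Type u} [CommRing R]
    {HN HF HT : Type u} [CommRing HN] [HopfAlgebra R HN] [CommRing HF] [HopfAlgebra R HF]
    [CommRing HT] [HopfAlgebra R HT] (φ : HF →ₐc[R] HN) (ψ : HT →ₐc[R] HF) : Prop where
  injective : ∀ (B : Type u) [CommRing B] [Algebra R B],
    Function.Injective fun x : HN →ₐ[R] B ↦ x.comp (φ : HF →ₐ[R] HN)
  exact : ∀ (B : Type u) [CommRing B] [Algebra R B] (y : HF →ₐ[R] B),
    (∃ x : HN →ₐ[R] B, x.comp (φ : HF →ₐ[R] HN) = y) ↔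
      y.comp (ψ : HT →ₐ[R] HF) = (Algebra.ofId R B).comp (Bialgebra.counitAlgHom R HT)
  locally_surjective : ∀ (B : Type u) [CommRing B] [Algebra R B] (z : HT →ₐ[R] B),
    ∃ (C : Type u) (_ : CommRing C) (_ : Algebra R C) (_ : Algebra B C)
      (_ : IsScalarTower R B C) (y : HF →ₐ[R] C),
      Module.FaithfullyFlat B C ∧ Algebra.FinitePresentation B C ∧
        y.comp (ψ : HT →ₐ[R] HF) = (IsScalarTower.toAlgHom R B C).comp z

/-- For a subring `A` of `S` and an ideal `P` of `S`: if the ideal `P ∩ A` of `A` is a minimal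
prime of a nonzero principal ideal of `A`, then it is principal. -/
def PrincipalContractionIfMinimal {R : Type*} [CommRing R] {S : Type*} [CommRing S] [Algebra R S]
    (A : Subalgebra R S) (P : Ideal S) : Prop :=
  (∃ a : A, a ≠ 0 ∧ P.comap A.val ∈ (Ideal.span {a}).minimalPrimes) →
    (P.comap A.val).IsPrincipal

/-! Write `A` for the ring in question, `S^N` or `S_G`. In both cases `A` is graded by a lattice ℤⁿ
of characters, its homogeneous elements being semiinvariants. In (1), two points of `F` with the
same image in `T` act alike on `N`-invariants, so by faithfully flat descent the coaction sends
`S^N` into `S ⊗ R[T]` (`coaction_mem_range_of_mem_invariants`), and `R[T]` has a basis of group-like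
elements. In (2), the characters of `G` are linearly independent and form a free abelian group of
finite rank (`exists_groupLike_indexing`).

The common argument is `isDomain_and_uniqueFactorizationMonoid_of_principalContraction`. A nonzero
homogeneous `f` is regular in `S`, and `fS ∩ A = fA`. A minimal prime `Q` of `fA` is therefore
homogeneous and contracted from a minimal prime `𝔭` of `fS`. Replacing `𝔭` by the largest stable
ideal inside it does not change the homogeneous elements it contains, hence not the contraction; the
height is one by Krull's theorem and regularity of `f`. The hypothesis makes `Q` principal, and its
generator is a homogeneous prime dividing `f`. As `S` is Noetherian, nonzero homogeneous elements
are products of homogeneous primes. In (1) the stable core of `𝔭` is only `F`-prime; in (2) it is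
prime, because `G` is geometrically integral (`isDomain_tensorProduct_of_smooth_of_connected`), so
minimality forces `𝔭` itself to be stable.

Inverting the nonzero homogeneous elements of `A` leaves a Laurent polynomial ring over a field, and
Nagata's criterion brings factoriality back to `A` (`uniqueFactorizationMonoid_of_graded`). As `A`
need not be Noetherian, the criterion is used in a form where the chain condition is replaced by a
bound on homogeneous divisors. -/

section Nagata

/-! ### Nagata's criterion without chain conditions. -/

variable {A : Type*} [CommRing A] [IsDomain A]

/-- An element of a prime ideal `Q` avoiding `M` can be divided by its largest divisor in `M`. -/
theorem exists_mem_forall_prime_not_dvd_of_dvd_prod {M : Submonoid A} {Q : Ideal A} [Q.IsPrime]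
    (hQM : Disjoint (M : Set A) Q) (l : Multiset A) (hl : ∀ p ∈ l, Prime p) {q : A} (hq : q ∈ Q)
    (hql : ∀ c ∈ M, c ∣ q → c ∣ l.prod) :
    ∃ q' ∈ Q, (∃ c ∈ M, q = c * q') ∧ ∀ p ∈ M, Prime p → ¬ p ∣ q' := by
  classical
  induction hn : l.card generalizing l q with
  | zero =>
    obtain rfl := Multiset.card_eq_zero.1 hn
    refine ⟨q, hq, ⟨1, M.one_mem, by simp⟩, fun p hpM hp hpq ↦ hp.not_isUnit ?_⟩
    exact isUnit_of_dvd_one (by simpa using hql p hpM hpq)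
  | succ n ih =>
    by_cases h : ∃ p ∈ M, Prime p ∧ p ∣ q
    · obtain ⟨p, hpM, hp, q', rfl⟩ := h
      have hpQ : p ∉ Q := fun h ↦ Set.disjoint_left.1 hQM hpM h
      have hq' : q' ∈ Q := (Ideal.IsPrime.mem_or_mem ‹_› hq).resolve_left hpQ
      obtain ⟨r, hr, hpr⟩ := hp.exists_mem_multiset_dvd (hql p hpM (dvd_mul_right _ _))
      have hass : Associated p r := hp.associated_of_dvd (hl r hr) hpr
      obtain ⟨q'', h1, ⟨c, hc, h2⟩, h3⟩ := ih (l.erase r)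
        (fun x hx ↦ hl x (Multiset.mem_of_mem_erase hx))
        hq' (fun c hc hcq ↦ by
          have := hql (p * c) (M.mul_mem hpM hc) (mul_dvd_mul_left p hcq)
          rw [← Multiset.prod_erase hr] at this
          have h2 : p * c ∣ p * (l.erase r).prod :=
            this.trans (mul_dvd_mul_right hass.symm.dvd _)
          exact (mul_dvd_mul_iff_left hp.ne_zero).1 h2)
        (by rw [Multiset.card_erase_of_mem hr, hn]; rfl)
      exact ⟨q'', h1, ⟨p * c, M.mul_mem hpM hc, by rw [h2, mul_assoc]⟩, h3⟩
    · push Not at h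
      exact ⟨q, hq, ⟨1, M.one_mem, by simp⟩, h⟩

/-- A version of Nagata's criterion without finiteness conditions on the ring: a domain is
factorial if its localization at a submonoid `M` of products of primes is, provided that the
divisors in `M` of a nonzero element are bounded. -/
theorem UniqueFactorizationMonoid.of_isLocalization_of_prime_factors (M : Submonoid A)
    (AM : Type*) [CommRing AM] [Algebra A AM] [IsLocalization M AM] [UniqueFactorizationMonoid AM]
    (h0 : (0 : A) ∉ M)
    (hfac : ∀ m ∈ M, ∃ l : Multiset A, (∀ p ∈ l, Prime p ∧ p ∈ M) ∧ Associated l.prod m)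
    (hbdd : ∀ a : A, a ≠ 0 → ∃ m ∈ M, ∀ c ∈ M, c ∣ a → c ∣ m) :
    UniqueFactorizationMonoid A := by
  have hM : M ≤ nonZeroDivisors A := le_nonZeroDivisors_of_noZeroDivisors h0
  have : IsDomain AM := IsLocalization.isDomain_of_le_nonZeroDivisors AM hM
  have hinj : Function.Injective (algebraMap A AM) := IsLocalization.injective AM hM
  -- Kaplansky's criterion: it suffices to find a prime element in each nonzero prime ideal.
  rw [iff_exists_prime_mem_of_isPrime]
  intro Q hQ0 hQ
  by_cases hd : Disjoint (M : Set A) Q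
  swap
  · obtain ⟨m, hm, hmQ⟩ := Set.not_disjoint_iff.1 hd
    obtain ⟨l, hl, hlm⟩ := hfac m hm
    have : l.prod ∈ Q := by
      obtain ⟨u, hu⟩ := hlm.symm
      rw [← hu]
      exact Q.mul_mem_right _ hmQ
    obtain ⟨p, hp, hpQ⟩ := (hQ.multiset_prod_mem_iff_exists_mem l).1 this
    exact ⟨p, hpQ, (hl p hp).1⟩
  have hprime := IsLocalization.isPrime_of_isPrime_disjoint M AM Q hQ hd
  have hne : Q.map (algebraMap A AM) ≠ ⊥ := by
    rwa [Ne, Ideal.map_eq_bot_iff_of_injective hinj]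
  obtain ⟨z, hz, hzp⟩ := hprime.exists_mem_prime_of_ne_bot hne
  obtain ⟨⟨⟨q, hq⟩, s⟩, hqs⟩ := (IsLocalization.mem_map_algebraMap_iff M AM).1 hz
  have hqp : Prime (algebraMap A AM q) := by
    rw [← hqs]
    exact ((associated_mul_unit_right z _ (IsLocalization.map_units AM s)).prime_iff).1 hzp
  have hq0 : q ≠ 0 := fun h ↦ hqp.ne_zero (by simp [h])
  obtain ⟨m, hm, hbd⟩ := hbdd q hq0
  obtain ⟨l, hl, hlm⟩ := hfac m hm
  obtain ⟨q', hq', ⟨c, hc, rfl⟩, hfree⟩ := exists_mem_forall_prime_not_dvd_of_dvd_prod hd l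
    (fun p hp ↦ (hl p hp).1) hq (fun c hc h ↦ (hbd c hc h).trans hlm.symm.dvd)
  have hqp' : Prime (algebraMap A AM q') := by
    rw [map_mul] at hqp
    exact ((associated_unit_mul_right _ _ (IsLocalization.map_units AM ⟨c, hc⟩)).prime_iff).2 hqp
  refine ⟨q', hq', fun h ↦ hqp'.ne_zero (by simp [h]),
    fun h ↦ hQ.ne_top (Ideal.eq_top_of_isUnit_mem _ hq' h), ?_⟩
  -- A denominator is a product of primes of `M`, none of which divides `q'`, so they can be
  -- cancelled one at a time.
  have key : ∀ a : A, algebraMap A AM q' ∣ algebraMap A AM a → q' ∣ a := by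
    rintro a ⟨w, hw⟩
    obtain ⟨⟨b, s⟩, hbs⟩ := IsLocalization.surj M w
    have h1 : a * s = q' * b := by
      apply hinj
      rw [map_mul, map_mul, ← hbs, hw, mul_assoc]
    obtain ⟨l, hl, u, hu⟩ := hfac s s.2
    have h2 : q' ∣ l.prod * a := by
      have : q' ∣ l.prod * u * a := by
        rw [hu, mul_comm, h1]
        exact dvd_mul_right _ _
      rwa [mul_right_comm, u.isUnit.dvd_mul_right] at this
    clear hu h1 hbs
    induction l using Multiset.induction_on with
    | empty => simpa using h2
    | cons p l ih =>
      refine ih (fun x hx ↦ hl x (Multiset.mem_cons_of_mem hx)) ?_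
      obtain ⟨hp, hpM⟩ := hl p (Multiset.mem_cons_self p l)
      obtain ⟨e, he⟩ := h2
      rw [Multiset.prod_cons, mul_assoc] at he
      obtain ⟨e', rfl⟩ := (hp.dvd_or_dvd (Dvd.intro _ he)).resolve_left (hfree p hpM hp)
      exact ⟨e', mul_left_cancel₀ hp.ne_zero (by rw [he]; ring)⟩
  intro a b hab
  have := hqp'.dvd_or_dvd (a := algebraMap A AM a) (b := algebraMap A AM b)
    (by rw [← map_mul]; exact map_dvd _ hab)
  exact this.imp (key a) (key b)

end Nagata

/-! ### Gradings as coactions of a group algebra. -/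

section GradedDomain

open DirectSum

variable {ι A σ : Type*} [AddCommGroup ι] [DecidableEq ι] [CommRing A] [SetLike σ A]
  [AddSubgroupClass σ A] (𝒜 : ι → σ) [GradedRing 𝒜]

/-- The coaction `a ↦ ∑ aᵢ tⁱ` of a graded ring. -/
noncomputable def gradingCoaction : A →+* AddMonoidAlgebra A ι :=
  (DirectSum.toSemiring (fun i ↦ (AddMonoidAlgebra.singleAddHom i).comp
      (AddSubmonoidClass.subtype (𝒜 i)))
    rfl (fun ai aj ↦ by simp [AddMonoidAlgebra.single_mul_single])).comp
    (decomposeRingEquiv 𝒜 : A →+* ⨁ i, 𝒜 i)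

theorem gradingCoaction_of_mem {i : ι} {a : A} (ha : a ∈ 𝒜 i) :
    gradingCoaction 𝒜 a = AddMonoidAlgebra.single i a := by
  have : decomposeRingEquiv 𝒜 a = DirectSum.of (fun i ↦ 𝒜 i) i ⟨a, ha⟩ :=
    decompose_of_mem 𝒜 ha
  rw [gradingCoaction, RingHom.comp_apply, RingHom.coe_coe, this]
  exact DirectSum.toSemiring_of _ _ _ _ _

theorem coeff_gradingCoaction (a : A) (i : ι) :
    (gradingCoaction 𝒜 a).coeff i = decompose 𝒜 a i := by
  classical
  induction a using DirectSum.Decomposition.inductionOn 𝒜 with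
  | zero => simp
  | @homogeneous j a =>
    rw [gradingCoaction_of_mem 𝒜 a.2, decompose_coe, AddMonoidAlgebra.coeff_single,
      Finsupp.single_apply, DirectSum.of_apply]
    split_ifs with h
    · subst h; simp
    · simp
  | add a b ha hb => simp [ha, hb, decompose_add]

theorem mem_of_gradingCoaction_eq_single {i : ι} {a : A}
    (h : gradingCoaction 𝒜 a = AddMonoidAlgebra.single i a) : a ∈ 𝒜 i := by
  have := coeff_gradingCoaction 𝒜 a i
  rw [h, AddMonoidAlgebra.coeff_single, Finsupp.single_eq_same] at this
  rw [this]
  exact (decompose 𝒜 a i).2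

/-- The multiplicative set of nonzero homogeneous elements of a graded domain. -/
def nonzeroHomogeneous [IsDomain A] : Submonoid A :=
  SetLike.homogeneousSubmonoid 𝒜 ⊓ nonZeroDivisors A

theorem mem_nonzeroHomogeneous [IsDomain A] {a : A} :
    a ∈ nonzeroHomogeneous 𝒜 ↔ (∃ i, a ∈ 𝒜 i) ∧ a ≠ 0 := by
  simp [nonzeroHomogeneous, Submonoid.mem_inf, SetLike.homogeneousSubmonoid,
    SetLike.IsHomogeneousElem]

end GradedDomain

section CoactedField

/-! Let `ρ : B → B[ι]` be a grading, presented as a coaction, for which all nonzero homogeneous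
elements are units. Then `B` is a Laurent polynomial ring over a field, in particular factorial. -/

variable {ι B : Type*} [AddCommGroup ι] [CommRing B]
  (ρ : B →+* AddMonoidAlgebra B ι)

/-- `z` is homogeneous of degree `i` for `ρ`. -/
def IsHomogeneousFor (i : ι) (z : B) : Prop := ρ z = AddMonoidAlgebra.single i z

variable {ρ}

namespace IsHomogeneousFor

theorem one : IsHomogeneousFor ρ 0 1 := by
  rw [IsHomogeneousFor, map_one]; rfl

theorem mul {i j : ι} {z w : B} (hz : IsHomogeneousFor ρ i z) (hw : IsHomogeneousFor ρ j w) :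
    IsHomogeneousFor ρ (i + j) (z * w) := by
  rw [IsHomogeneousFor, map_mul, hz, hw, AddMonoidAlgebra.single_mul_single]

theorem pow {i : ι} {z : B} (hz : IsHomogeneousFor ρ i z) (n : ℕ) :
    IsHomogeneousFor ρ (n • i) (z ^ n) := by
  rw [IsHomogeneousFor, map_pow, hz, AddMonoidAlgebra.single_pow]

theorem prod {κ : Type*} (s : Finset κ) {i : κ → ι} {z : κ → B}
    (h : ∀ k ∈ s, IsHomogeneousFor ρ (i k) (z k)) :
    IsHomogeneousFor ρ (∑ k ∈ s, i k) (∏ k ∈ s, z k) := by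
  classical
  induction s using Finset.induction_on with
  | empty => simpa using one
  | insert a s ha ih =>
    rw [Finset.sum_insert ha, Finset.prod_insert ha]
    exact (h a (by simp)).mul (ih fun k hk ↦ h k (by simp [hk]))

theorem of_mul_eq_one {i : ι} {z w : B} (hz : IsHomogeneousFor ρ i z) (h : z * w = 1) :
    IsHomogeneousFor ρ (-i) w := by
  have h1 : AddMonoidAlgebra.single i z * ρ w = 1 := by
    rw [← hz, ← map_mul, h, map_one]
  calc ρ w = (AddMonoidAlgebra.single (-i) w * AddMonoidAlgebra.single i z) * ρ w := by
        rw [AddMonoidAlgebra.single_mul_single, mul_comm w, h, neg_add_cancel]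
        exact (one_mul _).symm
    _ = _ := by rw [mul_assoc, h1, mul_one]

end IsHomogeneousFor

variable (ρ)

/-- The subring of elements of degree zero. -/
noncomputable def degreeZeroSubring : Subring B :=
  RingHom.eqLocus ρ AddMonoidAlgebra.singleZeroRingHom

variable [IsDomain B]

/-- The group of degrees of nonzero homogeneous elements. -/
def degreeGroup (hunit : ∀ i z, IsHomogeneousFor ρ i z → z ≠ 0 → IsUnit z) :
    Submodule ℤ ι := AddSubgroup.toIntSubmodule
  { carrier := {i | ∃ z, IsHomogeneousFor ρ i z ∧ z ≠ 0}
    zero_mem' := ⟨1, .one, one_ne_zero⟩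
    add_mem' := by
      rintro i j ⟨z, hz, hz0⟩ ⟨w, hw, hw0⟩
      exact ⟨z * w, hz.mul hw, mul_ne_zero hz0 hw0⟩
    neg_mem' := by
      rintro i ⟨z, hz, hz0⟩
      obtain ⟨w, hw⟩ := (hunit i z hz hz0).exists_right_inv
      exact ⟨w, hz.of_mul_eq_one hw, right_ne_zero_of_mul_eq_one hw⟩ }

theorem isField_degreeZeroSubring
    (hunit : ∀ i z, IsHomogeneousFor ρ i z → z ≠ 0 → IsUnit z) :
    IsField (degreeZeroSubring ρ) where
  exists_pair_ne := ⟨0, 1, zero_ne_one⟩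
  mul_comm := mul_comm
  mul_inv_cancel := by
    rintro ⟨z, hz⟩ h
    obtain ⟨w, hw⟩ := (hunit 0 z hz (fun h' ↦ h (Subtype.ext h'))).exists_right_inv
    have := IsHomogeneousFor.of_mul_eq_one (ρ := ρ) hz hw
    rw [neg_zero] at this
    exact ⟨⟨w, this⟩, Subtype.ext hw⟩

/-- The degrees that occur form a free group of finite rank. Units `x l` whose degrees are a basis
of it are algebraically independent over the field `K` of degree zero, and every homogeneous element
is a scalar times a Laurent monomial in them. So `B` is a localization of `K[x]`. -/
theorem uniqueFactorizationMonoid_of_isUnit_homogeneous [Module.Finite ℤ ι] [IsAddTorsionFree ι]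
    (hunit : ∀ i z, IsHomogeneousFor ρ i z → z ≠ 0 → IsUnit z)
    (hspan : ∀ z : B, z ∈ AddSubmonoid.closure {w | ∃ i, IsHomogeneousFor ρ i w}) :
    UniqueFactorizationMonoid B := by
  classical
  let K := degreeZeroSubring ρ
  have : UniqueFactorizationMonoid K := by
    have hK := isField_degreeZeroSubring ρ hunit
    let := hK.toField
    exact (inferInstance : UniqueFactorizationMonoid K)
  let Γ := degreeGroup ρ hunit
  let b := Module.finBasis ℤ Γ
  let d : Fin _ → ι := fun l ↦ b l
  have hx : ∀ l, ∃ z, IsHomogeneousFor ρ (d l) z ∧ z ≠ 0 := fun l ↦ (b l).2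
  choose x hx hx0 using hx
  have hd : LinearIndependent ℤ d := b.linearIndependent.map' Γ.subtype (Submodule.ker_subtype _)
  let φ : MvPolynomial (Fin _) K →ₐ[K] B := MvPolynomial.aeval x
  have hmon : ∀ (N : Fin _ →₀ ℕ), IsHomogeneousFor ρ (∑ l, N l • d l) (∏ l, x l ^ N l) :=
    fun N ↦ .prod _ fun l _ ↦ (hx l).pow _
  have hmon0 : ∀ (N : Fin _ →₀ ℕ), ∏ l, x l ^ N l ≠ 0 := fun N ↦
    Finset.prod_ne_zero_iff.2 fun l _ ↦ pow_ne_zero _ (hx0 l)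
  have hφ : ∀ (N : Fin _ →₀ ℕ) (c : K), φ (MvPolynomial.monomial N c) = c * ∏ l, x l ^ N l := by
    intro N c
    simp only [φ, MvPolynomial.aeval_monomial]
    rw [Finsupp.prod_fintype _ _ (by simp)]
    rfl
  -- Distinct monomials have distinct degrees, so `ρ` separates the terms of a polynomial relation.
  have hdeg : Function.Injective fun N : Fin _ →₀ ℕ ↦ ∑ l, N l • d l := by
    intro N N' h
    have h1 : ∑ l, ((N l : ℤ) - N' l) • d l = 0 := by
      simp only [sub_smul, Finset.sum_sub_distrib, natCast_zsmul]
      exact sub_eq_zero.2 h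
    ext l
    have := Fintype.linearIndependent_iff.1 hd _ h1 l
    omega
  have hinj : Function.Injective φ := by
    rw [injective_iff_map_eq_zero]
    intro f hf
    ext N
    have h1 : ∑ N' ∈ f.support, AddMonoidAlgebra.single (∑ l, N' l • d l)
        (φ (MvPolynomial.monomial N' (f.coeff N'))) = 0 := by
      rw [← map_zero ρ, ← hf]
      conv_rhs => rw [f.as_sum, map_sum, map_sum]
      refine Finset.sum_congr rfl fun N' _ ↦ ?_
      rw [hφ]
      have := IsHomogeneousFor.mul (ρ := ρ) (f.coeff N').2 (hmon N')
      rw [zero_add] at this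
      exact this.symm
    by_contra hN
    have h2 := congrArg (fun t ↦ t.coeff (∑ l, N l • d l)) h1
    simp only [AddMonoidAlgebra.coeff_sum, AddMonoidAlgebra.coeff_single, Finsupp.finsetSum_apply,
      Finsupp.single_apply, hdeg.eq_iff] at h2
    rw [Finset.sum_ite_eq' , if_pos (MvPolynomial.mem_support_iff.2 (by simpa using hN)), hφ] at h2
    have : ((f.coeff N : K) : B) = 0 := (mul_eq_zero.1 (by simpa using h2)).resolve_right (hmon0 N)
    exact hN (by simpa using this)
  have hsurj : ∀ z : B, ∃ (N : Fin _ →₀ ℕ) (f : MvPolynomial (Fin _) K),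
      z * ∏ l, x l ^ N l = φ f := by
    intro z
    induction hspan z using AddSubmonoid.closure_induction with
    | zero => exact ⟨0, 0, by simp⟩
    | add z w _ _ hz hw =>
      obtain ⟨N, f, hf⟩ := hz
      obtain ⟨N', g, hg⟩ := hw
      refine ⟨N + N', f * MvPolynomial.monomial N' 1 + g * MvPolynomial.monomial N 1, ?_⟩
      rw [map_add, map_mul, map_mul, hφ, hφ, ← hf, ← hg]
      simp only [Finsupp.add_apply, pow_add, Finset.prod_mul_distrib, OneMemClass.coe_one]
      ring
    | mem z hz =>
      obtain ⟨γ, hz⟩ := hz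
      by_cases hz0 : z = 0
      · exact ⟨0, 0, by simp [hz0]⟩
      have hγ : γ ∈ Γ := ⟨z, hz, hz0⟩
      let n := b.repr ⟨γ, hγ⟩
      have hn : ∑ l, n l • d l = γ := by
        have := congrArg (Γ.subtype) (b.sum_repr ⟨γ, hγ⟩)
        rw [map_sum] at this
        simp only [map_zsmul] at this
        exact this
      -- Positive and negative parts of the degree of `z`: the element `z * x ^ N / x ^ P` has
      -- degree zero, hence is a scalar.
      let P : Fin _ →₀ ℕ := Finsupp.equivFunOnFinite.symm fun l ↦ (n l).toNat
      let N : Fin _ →₀ ℕ := Finsupp.equivFunOnFinite.symm fun l ↦ (-n l).toNat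
      have hPN : γ + ∑ l, N l • d l = ∑ l, P l • d l := by
        rw [← hn, ← Finset.sum_add_distrib]
        refine Finset.sum_congr rfl fun l _ ↦ ?_
        rw [← natCast_zsmul, ← natCast_zsmul, ← add_smul]
        congr 1
        simp only [N, P, Finsupp.equivFunOnFinite_symm_apply_apply]
        omega
      obtain ⟨w, hw⟩ := (hunit _ _ (hmon P) (hmon0 P)).exists_right_inv
      have h1 := (hz.mul (hmon N)).mul ((hmon P).of_mul_eq_one hw)
      rw [hPN, add_neg_cancel] at h1
      refine ⟨N, MvPolynomial.monomial P ⟨_, h1⟩, ?_⟩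
      rw [hφ, mul_assoc _ w, mul_comm w, hw, mul_one]
  let : Algebra (MvPolynomial (Fin (Module.finrank ℤ Γ)) K) B := φ.toRingHom.toAlgebra
  let W : Submonoid (MvPolynomial (Fin (Module.finrank ℤ Γ)) K) :=
    (IsUnit.submonoid B).comap φ
  have : IsLocalization W B :=
    { map_units := fun y ↦ y.2
      surj := fun z ↦ by
        obtain ⟨N, f, hf⟩ := hsurj z
        have hN : φ (MvPolynomial.monomial N 1) = ∏ l, x l ^ N l := by rw [hφ]; simp
        refine ⟨(f, ⟨MvPolynomial.monomial N 1, ?_⟩), ?_⟩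
        · change IsUnit (φ (MvPolynomial.monomial N 1))
          rw [hN]
          exact hunit _ _ (hmon N) (hmon0 N)
        · change z * φ (MvPolynomial.monomial N 1) = φ f
          rw [hN, hf]
      exists_of_eq := fun {f g} h ↦ ⟨1, by rw [hinj h]⟩ }
  exact UniqueFactorizationMonoid.of_isLocalization W B

end CoactedField

/-! ### Factoriality of graded domains. -/

section GradedFactorial

open DirectSum

variable {ι A σ : Type*} [AddCommGroup ι] [DecidableEq ι] [CommRing A] [SetLike σ A]
  [AddSubgroupClass σ A] (𝒜 : ι → σ) [GradedRing 𝒜]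

/-- The coaction extends to the localization because it sends a denominator `a` of degree `i` to `a
tⁱ`, a unit there. -/
theorem exists_gradingCoaction_localization [IsDomain A] :
    ∃ ρ : Localization (nonzeroHomogeneous 𝒜) →+*
        AddMonoidAlgebra (Localization (nonzeroHomogeneous 𝒜)) ι,
      ∀ a, ρ (algebraMap A _ a) =
        AddMonoidAlgebra.mapRingHom ι (algebraMap A _) (gradingCoaction 𝒜 a) := by
  let g : A →+* AddMonoidAlgebra (Localization (nonzeroHomogeneous 𝒜)) ι :=
    (AddMonoidAlgebra.mapRingHom ι (algebraMap A _)).comp (gradingCoaction 𝒜)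
  have hg : ∀ y : nonzeroHomogeneous 𝒜, IsUnit (g y) := by
    rintro ⟨y, hy⟩
    obtain ⟨⟨i, hi⟩, -⟩ := (mem_nonzeroHomogeneous 𝒜).1 hy
    obtain ⟨w, hw⟩ := (IsLocalization.map_units (Localization (nonzeroHomogeneous 𝒜))
      ⟨y, hy⟩).exists_right_inv
    refine IsUnit.of_mul_eq_one (AddMonoidAlgebra.single (-i) w) ?_
    simp only [g, RingHom.comp_apply, gradingCoaction_of_mem 𝒜 hi,
      AddMonoidAlgebra.mapRingHom_single,
      AddMonoidAlgebra.single_mul_single, hw, add_neg_cancel]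
    rfl
  exact ⟨IsLocalization.lift hg, fun a ↦ IsLocalization.lift_eq hg a⟩

/-- A domain graded by a finitely generated torsion free group is factorial if its nonzero
homogeneous elements are products of homogeneous primes. -/
theorem uniqueFactorizationMonoid_of_graded [IsDomain A] [Module.Finite ℤ ι] [IsAddTorsionFree ι]
    (hfac : ∀ m : A, (∃ i, m ∈ 𝒜 i) → m ≠ 0 →
      ∃ l : Multiset A, (∀ p ∈ l, Prime p ∧ ∃ i, p ∈ 𝒜 i) ∧ Associated l.prod m) :
    UniqueFactorizationMonoid A := by
  let M := nonzeroHomogeneous 𝒜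
  have h0 : (0 : A) ∉ M := fun h ↦ ((mem_nonzeroHomogeneous 𝒜).1 h).2 rfl
  have hM : M ≤ nonZeroDivisors A := le_nonZeroDivisors_of_noZeroDivisors h0
  have : IsDomain (Localization M) := IsLocalization.isDomain_of_le_nonZeroDivisors _ hM
  have hinj : Function.Injective (algebraMap A (Localization M)) := IsLocalization.injective _ hM
  obtain ⟨ρ, hρ⟩ := exists_gradingCoaction_localization 𝒜
  have hhom : ∀ {i a}, a ∈ 𝒜 i → IsHomogeneousFor ρ i (algebraMap A (Localization M) a) := by
    intro i a ha
    rw [IsHomogeneousFor, hρ, gradingCoaction_of_mem 𝒜 ha, AddMonoidAlgebra.mapRingHom_single]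
  have hhom' : ∀ {i a}, IsHomogeneousFor ρ i (algebraMap A (Localization M) a) → a ∈ 𝒜 i := by
    intro i a ha
    rw [IsHomogeneousFor, hρ] at ha
    have h1 := congrArg (fun t ↦ t.coeff) ha
    apply mem_of_gradingCoaction_eq_single
    ext j
    apply hinj
    have h2 := DFunLike.congr_fun h1 j
    classical
    simp only [AddMonoidAlgebra.coeff_mapRingHom, AddMonoidAlgebra.coeff_single,
      Finsupp.single_apply] at h2 ⊢
    split_ifs at h2 ⊢
    · exact h2
    · exact h2.trans (map_zero _).symm
  have hunit : ∀ i z, IsHomogeneousFor ρ i z → z ≠ 0 → IsUnit z := by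
    intro i z hz hz0
    obtain ⟨⟨a, s⟩, has⟩ := IsLocalization.surj M z
    obtain ⟨⟨j, hj⟩, -⟩ := (mem_nonzeroHomogeneous 𝒜).1 s.2
    have ha := hhom' (has ▸ hz.mul (hhom hj))
    have ha0 : a ≠ 0 := by
      rintro rfl
      rw [map_zero] at has
      exact hz0 (((IsLocalization.map_units (Localization M) s).mul_left_eq_zero).1 has)
    have hu : IsUnit (algebraMap A (Localization M) a) := IsLocalization.map_units (Localization M)
      (⟨a, (mem_nonzeroHomogeneous 𝒜).2 ⟨⟨_, ha⟩, ha0⟩⟩ : M)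
    rw [← has] at hu
    exact isUnit_of_mul_isUnit_left hu
  have : UniqueFactorizationMonoid (Localization M) := by
    refine uniqueFactorizationMonoid_of_isUnit_homogeneous ρ hunit fun z ↦ ?_
    obtain ⟨⟨a, s⟩, has⟩ := IsLocalization.surj M z
    obtain ⟨⟨j, hj⟩, -⟩ := (mem_nonzeroHomogeneous 𝒜).1 s.2
    obtain ⟨w, hw⟩ := (IsLocalization.map_units (Localization M) s).exists_right_inv
    have hz : z = algebraMap A _ a * w := by rw [← has, mul_assoc, hw, mul_one]
    classical
    rw [hz, ← sum_support_decompose 𝒜 a, map_sum, Finset.sum_mul]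
    refine sum_mem fun i _ ↦ AddSubmonoid.subset_closure ⟨i + -j, ?_⟩
    exact (hhom (decompose 𝒜 a i).2).mul ((hhom hj).of_mul_eq_one hw)
  refine UniqueFactorizationMonoid.of_isLocalization_of_prime_factors M (Localization M) h0 ?_ ?_
  · intro m hm
    obtain ⟨h1, h2⟩ := (mem_nonzeroHomogeneous 𝒜).1 hm
    obtain ⟨l, hl, hlm⟩ := hfac m h1 h2
    exact ⟨l, fun p hp ↦ ⟨(hl p hp).1, (mem_nonzeroHomogeneous 𝒜).2 ⟨(hl p hp).2,
      (hl p hp).1.ne_zero⟩⟩, hlm⟩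
  · intro a ha
    obtain ⟨i, hi⟩ : ∃ i, (decompose 𝒜 a i : A) ≠ 0 := by
      by_contra! h
      apply ha
      classical
      rw [← sum_support_decompose 𝒜 a]
      exact Finset.sum_eq_zero fun i _ ↦ h i
    -- A homogeneous divisor of `a` divides each component of `a`, so any nonzero component is a
    -- bound.
    refine ⟨_, (mem_nonzeroHomogeneous 𝒜).2 ⟨⟨i, (decompose 𝒜 a i).2⟩, hi⟩, ?_⟩
    rintro c hc ⟨e, rfl⟩
    obtain ⟨⟨j, hj⟩, -⟩ := (mem_nonzeroHomogeneous 𝒜).1 hc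
    refine ⟨decompose 𝒜 e (-j + i), ?_⟩
    rw [← coe_decompose_mul_add_of_left_mem 𝒜 hj, add_neg_cancel_left]

end GradedFactorial

/-! ### Factors of homogeneous elements. -/

section HomogeneousFactors

open DirectSum

variable {ι A σ : Type*} [AddCommGroup ι] [DecidableEq ι] [TwoUniqueSums ι]
  [CommRing A] [IsDomain A] [SetLike σ A]
  [AddSubgroupClass σ A] (𝒜 : ι → σ) [GradedRing 𝒜]

/-- In a domain graded by a group with unique sums, factors of nonzero homogeneous elements are
homogeneous. -/
theorem exists_mem_of_mul_mem {i : ι} {a b : A} (h : a * b ∈ 𝒜 i) (h0 : a * b ≠ 0) :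
    ∃ j, a ∈ 𝒜 j := by
  classical
  let s := (decompose 𝒜 a).support
  let t := (decompose 𝒜 b).support
  have hs : s.Nonempty := by
    by_contra hs
    refine left_ne_zero_of_mul h0 ?_
    rw [← sum_support_decompose 𝒜 a]
    exact Finset.sum_eq_zero fun i hi ↦ (hs ⟨i, hi⟩).elim
  have ht : t.Nonempty := by
    by_contra hs
    refine right_ne_zero_of_mul h0 ?_
    rw [← sum_support_decompose 𝒜 b]
    exact Finset.sum_eq_zero fun i hi ↦ (hs ⟨i, hi⟩).elim
  -- Where a degree is a sum in only one way, the component of `a * b` there is a single product of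
  -- nonzero components and cannot cancel.
  have key : ∀ p ∈ s ×ˢ t, UniqueAdd s t p.1 p.2 → p.1 + p.2 = i := by
    rintro ⟨k, l⟩ hp hu
    obtain ⟨hk, hl⟩ := Finset.mem_product.1 hp
    by_contra hne
    have h1 : (decompose 𝒜 (a * b) (k + l) : A) = 0 := by
      rw [decompose_of_mem 𝒜 h, of_eq_of_ne _ _ _ hne]
      rfl
    rw [decompose_mul, coe_mul_apply, Finset.sum_eq_single (k, l)] at h1
    · simp only [mul_eq_zero, ZeroMemClass.coe_eq_zero] at h1
      exact h1.elim (DFinsupp.mem_support_iff.1 hk) (DFinsupp.mem_support_iff.1 hl)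
    · rintro ⟨k', l'⟩ hp' hne'
      simp only [Finset.mem_filter, Finset.mem_product] at hp'
      obtain ⟨rfl, rfl⟩ := hu hp'.1.1 hp'.1.2 hp'.2
      exact (hne' rfl).elim
    · intro hn
      simp only [Finset.mem_filter, Finset.mem_product, and_true] at hn
      exact (hn ⟨hk, hl⟩).elim
  -- Otherwise there are two unique sums; both equal `i`, which contradicts uniqueness.
  have hcard : s.card * t.card ≤ 1 := by
    by_contra! hc
    obtain ⟨p, hp, q, hq, hpq, hpu, hqu⟩ := TwoUniqueSums.uniqueAdd_of_one_lt_card hc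
    obtain ⟨h1, h2⟩ := Finset.mem_product.1 hq
    obtain ⟨h3, h4⟩ := hpu h1 h2 ((key q hq hqu).trans (key p hp hpu).symm)
    exact hpq (Prod.ext h3.symm h4.symm)
  have hs1 : s.card = 1 := by
    have := Finset.card_pos.2 hs
    have := Finset.card_pos.2 ht
    nlinarith
  obtain ⟨j, hj⟩ := Finset.card_eq_one.1 hs1
  refine ⟨j, ?_⟩
  rw [← sum_support_decompose 𝒜 a]
  change ∑ i ∈ s, _ ∈ _
  rw [hj, Finset.sum_singleton]
  exact (decompose 𝒜 a j).2

end HomogeneousFactors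

/-! ### From principal contractions to unique factorization. -/

section Descent

open DirectSum

variable {R : Type*} [CommRing R] {S : Type*} [CommRing S] [Algebra R S]
  {ι : Type*} [AddCommGroup ι] [LinearOrder ι] [IsOrderedCancelAddMonoid ι]

theorem one_le_height_of_mem_nonZeroDivisors {I : Ideal S} {f : S} (hf : f ∈ nonZeroDivisors S)
    (hfI : f ∈ I) : 1 ≤ I.height :=
  (Ideal.one_le_height_span_singleton_of_mem_nonZeroDivisors hf).trans
    (Ideal.height_mono ((Ideal.span_singleton_le_iff_mem _).2 hfI))

/-- A graded subring `A` of a Noetherian ring `S` is a factorial domain, if the minimal primes of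
nonzero homogeneous elements that are contracted from primes of height one are principal. -/
theorem isDomain_and_uniqueFactorizationMonoid_of_principalContraction
    (A : Subalgebra R S) [Nontrivial A] (𝒜 : ι → Submodule R A) [GradedRing 𝒜]
    [Module.Finite ℤ ι] [IsNoetherianRing S]
    (hreg : ∀ i, ∀ f ∈ 𝒜 i, f ≠ 0 → (f : S) ∈ nonZeroDivisors S)
    (hdiv : ∀ i, ∀ f ∈ 𝒜 i, f ≠ 0 → ∀ s : S, (f : S) * s ∈ A → s ∈ A)
    (hcore : ∀ i, ∀ f ∈ 𝒜 i, f ≠ 0 → ∀ 𝔭 ∈ (Ideal.span {(f : S)}).minimalPrimes,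
      ∃ P ≤ 𝔭, (∀ j, ∀ g ∈ 𝒜 j, (g : S) ∈ 𝔭 → (g : S) ∈ P) ∧
        (P.height = 1 → PrincipalContractionIfMinimal A P)) :
    IsDomain A ∧ UniqueFactorizationMonoid A := by
  have hdom : IsDomain A := by
    have : (⊥ : Ideal A).IsPrime := by
      refine Ideal.IsHomogeneous.isPrime_of_homogeneous_mem_or_mem (𝒜 := 𝒜) (Ideal.IsHomogeneous.bot 𝒜)
        bot_ne_top ?_
      rintro x y ⟨i, hi⟩ - hxy
      simp only [Ideal.mem_bot] at hxy ⊢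
      by_cases hx : x = 0
      · exact .inl hx
      refine .inr (Subtype.ext ?_)
      have h1 : (x : S) * y = 0 := by simpa using congrArg A.val hxy
      exact (mul_left_mem_nonZeroDivisors_eq_zero_iff (hreg i x hi hx)).1 h1
    exact IsDomain.of_bot_isPrime A
  refine ⟨hdom, ?_⟩
  have hunit : ∀ i, ∀ f ∈ 𝒜 i, f ≠ 0 → IsUnit (f : S) → IsUnit f := by
    intro i f hf hf0 hu
    obtain ⟨w, hw⟩ := hu.exists_right_inv
    exact IsUnit.of_mul_eq_one ⟨w, hdiv i f hf hf0 w (hw ▸ A.one_mem)⟩ (Subtype.ext hw)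
  have hprime : ∀ i, ∀ f ∈ 𝒜 i, f ≠ 0 → ¬ IsUnit f →
      ∃ p, Prime p ∧ (∃ j, p ∈ 𝒜 j) ∧ p ∣ f := by
    intro i f hf hf0 hfu
    obtain ⟨Q, hQ⟩ : (Ideal.span {f}).minimalPrimes.Nonempty :=
      Set.nonempty_coe_sort.1
        (Ideal.nonempty_minimalPrimes (by rwa [Ne, Ideal.span_singleton_eq_top]))
    have hQp : Q.IsPrime := hQ.1.1
    have hfQ : f ∈ Q := hQ.1.2 (Ideal.mem_span_singleton_self f)
    have hQhom : ∀ q ∈ Q, ∀ j, (decompose 𝒜 q j : A) ∈ Q := by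
      have h1 : Q ≤ (Q.homogeneousCore 𝒜).toIdeal := by
        refine hQ.2 ⟨hQp.homogeneousCore, ?_⟩ (Ideal.toIdeal_homogeneousCore_le 𝒜 Q)
        rw [Ideal.span_singleton_le_iff_mem]
        exact Ideal.mem_homogeneousCore_of_homogeneous_of_mem ⟨i, hf⟩ hfQ
      intro q hq j
      exact Ideal.toIdeal_homogeneousCore_le 𝒜 Q ((Q.homogeneousCore 𝒜).isHomogeneous j (h1 hq))
    -- This equality is what makes `Q` the contraction of a minimal prime of `fS`.
    have hcomap : (Ideal.span {(f : S)}).comap (A.val : A →+* S) = Ideal.span {f} := by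
      ext a
      rw [Ideal.mem_comap, Ideal.mem_span_singleton', Ideal.mem_span_singleton']
      constructor
      · rintro ⟨s, hs⟩
        have hs' : (f : S) * s = a := by rw [mul_comm]; exact hs
        exact ⟨⟨s, hdiv i f hf hf0 s (hs' ▸ a.2)⟩, Subtype.ext hs⟩
      · rintro ⟨s, rfl⟩
        exact ⟨s, rfl⟩
    obtain ⟨𝔭, h𝔭, h𝔭Q⟩ := Ideal.exists_minimalPrimes_comap_eq (A.val : A →+* S) Q (hcomap ▸ hQ)
    obtain ⟨P, hP𝔭, hPhom, hP⟩ := hcore i f hf hf0 𝔭 h𝔭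
    have hmem : ∀ a : A, (a : S) ∈ 𝔭 ↔ a ∈ Q := fun a ↦ by rw [← h𝔭Q]; rfl
    -- `Q` is homogeneous, and `P` keeps all homogeneous elements of `𝔭`.
    have hPQ : P.comap A.val = Q := by
      apply le_antisymm
      · intro a ha
        exact (hmem a).1 (hP𝔭 ha)
      · classical
        intro a ha
        rw [← sum_support_decompose 𝒜 a]
        exact sum_mem fun j _ ↦ hPhom j _ (decompose 𝒜 a j).2 ((hmem _).2 (hQhom a ha j))
    -- The upper bound is Krull's principal ideal theorem for `𝔭`; the lower bound holds because `P`
    -- contains the regular element `f`.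
    have hht : P.height = 1 := by
      have : 𝔭.IsPrime := h𝔭.1.1
      refine le_antisymm ((Ideal.height_mono hP𝔭).trans ?_)
        (one_le_height_of_mem_nonZeroDivisors (hreg i f hf hf0) (hPhom i f hf ((hmem f).2 hfQ)))
      exact Ideal.height_le_one_of_isPrincipal_of_mem_minimalPrimes _ 𝔭 h𝔭
    have hprin : Q.IsPrincipal := hPQ ▸ hP hht ⟨f, hf0, hPQ ▸ hQ⟩
    have hQ0 : Q ≠ ⊥ := fun h ↦ hf0 (by rwa [h] at hfQ)
    have hpf : hprin.generator Q ∣ f := (Submodule.IsPrincipal.mem_iff_generator_dvd Q).1 hfQ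
    refine ⟨_, hprin.prime_generator_of_isPrime Q hQ0, ?_, hpf⟩
    obtain ⟨g, hg⟩ := hpf
    exact exists_mem_of_mul_mem 𝒜 (hg ▸ hf) (hg ▸ hf0)
  refine uniqueFactorizationMonoid_of_graded 𝒜 ?_
  rintro m ⟨i, hm⟩ hm0
  -- The induction runs over ideals of `S`, since `A` is not known to be Noetherian.
  induction hI : Ideal.span {(m : S)} using
    (inferInstance : WellFoundedGT (Ideal S)).induction generalizing m i with
  | ind I ih =>
    subst hI
    by_cases hu : IsUnit m
    · exact ⟨0, by simp, by simpa using (associated_one_iff_isUnit.2 hu).symm⟩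
    obtain ⟨p, hp, ⟨j, hpj⟩, g, rfl⟩ := hprime i m hm hm0 hu
    have hg0 : g ≠ 0 := right_ne_zero_of_mul hm0
    obtain ⟨k, hg⟩ : ∃ k, g ∈ 𝒜 k :=
      exists_mem_of_mul_mem 𝒜 (a := g) (b := p) (mul_comm p g ▸ hm) (mul_comm p g ▸ hm0)
    obtain ⟨l, hl, hlg⟩ := ih (Ideal.span {(g : S)}) (by
      -- If `gS = pgS`, cancelling the regular element `g` makes `p` a unit of `S`, hence of `A`.
      refine lt_of_le_of_ne ?_ fun h ↦ hp.not_isUnit (hunit j p hpj hp.ne_zero ?_)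
      · rw [Ideal.span_singleton_le_span_singleton]
        exact ⟨p, mul_comm _ _⟩
      · have : (g : S) ∈ Ideal.span {((p * g : A) : S)} := by
          rw [h]; exact Ideal.mem_span_singleton_self _
        obtain ⟨w, hw⟩ := Ideal.mem_span_singleton'.1 this
        refine IsUnit.of_mul_eq_one w ?_
        have h1 : (g : S) * (p * w - 1) = 0 := by
          rw [mul_sub, mul_one, sub_eq_zero]
          conv_rhs => rw [← hw]
          push_cast
          ring
        exact sub_eq_zero.1 ((mul_left_mem_nonZeroDivisors_eq_zero_iff (hreg k g hg hg0)).1 h1))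
      g k hg hg0 rfl
    refine ⟨p ::ₘ l, ?_, ?_⟩
    · intro q hq
      rcases Multiset.mem_cons.1 hq with rfl | hq
      · exact ⟨hp, j, hpj⟩
      · exact hl q hq
    · rw [Multiset.prod_cons]
      exact hlg.mul_left p

end Descent

namespace GroupSchemeAction

/-! ### Stable ideals, stable cores and semiinvariants. -/

section Stable

variable {R : Type*} [CommRing R] {H : Type*} [CommRing H] [HopfAlgebra R H]
  {S : Type*} [CommRing S] [Algebra R S]

/-- By flatness of `H` the kernel of `g ⊗ H` is the image of `ker g ⊗ H`. All stability proofs go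
through this. -/
theorem mem_map_includeLeft_of_rTensor_eq_zero [Module.Flat R H] {M : Type*} [AddCommGroup M]
    [Module R M] (g : S →ₗ[R] M) (I : Ideal S) (hI : ∀ s, g s = 0 → s ∈ I) {x : S ⊗[R] H}
    (hx : g.rTensor H x = 0) :
    x ∈ I.map (Algebra.TensorProduct.includeLeft : S →ₐ[R] S ⊗[R] H) := by
  have hex := Module.Flat.rTensor_exact H (f := (LinearMap.ker g).subtype) (g := g)
    (LinearMap.exact_subtype_ker_map g)
  obtain ⟨y, rfl⟩ := (hex x).1 hx
  clear hx
  induction y with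
  | zero => simp
  | add a b ha hb => rw [map_add]; exact add_mem ha hb
  | tmul s h =>
    rw [LinearMap.rTensor_tmul]
    have : (s : S) ⊗ₜ[R] h = (s : S) ⊗ₜ[R] (1 : H) * (1 : S) ⊗ₜ[R] h := by simp
    rw [Submodule.subtype_apply, this]
    exact Ideal.mul_mem_right _ _ (Ideal.mem_map_of_mem _ (hI s s.2))

theorem map_mk_eq_zero_of_mem_map_includeLeft {I : Ideal S} {x : S ⊗[R] H}
    (hx : x ∈ I.map (Algebra.TensorProduct.includeLeft : S →ₐ[R] S ⊗[R] H)) :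
    Algebra.TensorProduct.map (Ideal.Quotient.mkₐ R I) (AlgHom.id R H) x = 0 := by
  have : I.map (Algebra.TensorProduct.includeLeft : S →ₐ[R] S ⊗[R] H) ≤
      RingHom.ker (Algebra.TensorProduct.map (Ideal.Quotient.mkₐ R I) (AlgHom.id R H)) := by
    rw [Ideal.map_le_iff_le_comap]
    intro s hs
    rw [Ideal.mem_comap, RingHom.mem_ker]
    simp [Ideal.Quotient.eq_zero_iff_mem.2 hs]
  exact this hx

theorem mem_map_includeLeft_iff [Module.Flat R H] {I : Ideal S} {x : S ⊗[R] H} :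
    x ∈ I.map (Algebra.TensorProduct.includeLeft : S →ₐ[R] S ⊗[R] H) ↔
      Algebra.TensorProduct.map (Ideal.Quotient.mkₐ R I) (AlgHom.id R H) x = 0 := by
  refine ⟨map_mk_eq_zero_of_mem_map_includeLeft, fun h ↦ ?_⟩
  exact mem_map_includeLeft_of_rTensor_eq_zero (Ideal.Quotient.mkₐ R I).toLinearMap I
    (fun s hs ↦ Ideal.Quotient.eq_zero_iff_mem.1 hs) h

variable (act : GroupSchemeAction R H S)

/-- The largest stable ideal contained in an ideal. -/
def core (I : Ideal S) : Ideal S :=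
  (I.map (Algebra.TensorProduct.includeLeft : S →ₐ[R] S ⊗[R] H)).comap act.coaction

/-- The counit on the second factor turns `ω(s)` back into `s` and the extension of `I` back into
`I`. -/
theorem core_le (I : Ideal S) : act.core I ≤ I := by
  intro s hs
  have h1 : I.map (Algebra.TensorProduct.includeLeft : S →ₐ[R] S ⊗[R] H) ≤
      (I.map (Algebra.TensorProduct.includeLeft : S →ₐ[R] S ⊗[R] R)).comap
        (Algebra.TensorProduct.map (AlgHom.id R S) (Bialgebra.counitAlgHom R H)) := by
    rw [Ideal.map_le_iff_le_comap]
    intro a ha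
    rw [Ideal.mem_comap, Ideal.mem_comap]
    simpa using Ideal.mem_map_of_mem (Algebra.TensorProduct.includeLeft : S →ₐ[R] S ⊗[R] R) ha
  have h2 := h1 hs
  rw [Ideal.mem_comap, ← AlgHom.comp_apply, act.counit] at h2
  have h3 : I.map (Algebra.TensorProduct.includeLeft : S →ₐ[R] S ⊗[R] R) ≤
      I.comap (Algebra.TensorProduct.rid R R S : S ⊗[R] R →ₐ[R] S) := by
    rw [Ideal.map_le_iff_le_comap]
    intro a ha
    simpa [Ideal.mem_comap] using ha
  simpa using h3 h2

theorem IsStable.le_core {I P : Ideal S} (hI : act.IsStable I) (h : I ≤ P) : I ≤ act.core P :=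
  fun _ ha ↦ Ideal.map_mono h (hI _ ha)

/-- The core is the kernel of `κ : S → (S ⧸ I) ⊗ H` induced by `ω`. By coassociativity `(κ ⊗ H) ∘ ω`
factors through `κ`, so it kills this kernel; flatness concludes. -/
theorem isStable_core [Module.Flat R H] (I : Ideal S) : act.IsStable (act.core I) := by
  intro s hs
  let q : S ⊗[R] H →ₐ[R] (S ⧸ I) ⊗[R] H :=
    Algebra.TensorProduct.map (Ideal.Quotient.mkₐ R I) (AlgHom.id R H)
  have hq : q (act.coaction s) = 0 := map_mk_eq_zero_of_mem_map_includeLeft hs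
  refine mem_map_includeLeft_of_rTensor_eq_zero (q.comp act.coaction).toLinearMap _
    (fun a ha ↦ mem_map_includeLeft_iff.2 ha) ?_
  let Δ : (S ⧸ I) ⊗[R] H →ₐ[R] (S ⧸ I) ⊗[R] (H ⊗[R] H) :=
    Algebra.TensorProduct.map (AlgHom.id R (S ⧸ I)) (Bialgebra.comulAlgHom R H)
  have key : (Algebra.TensorProduct.assoc R R R (S ⧸ I) H H).toAlgHom.comp
      ((Algebra.TensorProduct.map (q.comp act.coaction) (AlgHom.id R H)).comp act.coaction) =
      Δ.comp (q.comp act.coaction) := by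
    have e1 : (Algebra.TensorProduct.assoc R R R (S ⧸ I) H H).toAlgHom.comp
        (Algebra.TensorProduct.map q (AlgHom.id R H)) =
        (Algebra.TensorProduct.map (Ideal.Quotient.mkₐ R I) (AlgHom.id R (H ⊗[R] H))).comp
          (Algebra.TensorProduct.assoc R R R S H H).toAlgHom := by
      ext <;> simp [q, Algebra.TensorProduct.one_def]
    have e2 : (Algebra.TensorProduct.map (Ideal.Quotient.mkₐ R I) (AlgHom.id R (H ⊗[R] H))).comp
        (Algebra.TensorProduct.map (AlgHom.id R S) (Bialgebra.comulAlgHom R H)) = Δ.comp q := by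
      simp only [q, Δ, ← Algebra.TensorProduct.map_comp]
      rfl
    have e3 : Algebra.TensorProduct.map (q.comp act.coaction) (AlgHom.id R H) =
        (Algebra.TensorProduct.map q (AlgHom.id R H)).comp
          (Algebra.TensorProduct.map act.coaction (AlgHom.id R H)) := by
      rw [← Algebra.TensorProduct.map_comp]
      rfl
    rw [e3, AlgHom.comp_assoc, ← AlgHom.comp_assoc, e1, AlgHom.comp_assoc,
      ← AlgHom.comp_assoc _ _ act.coaction, act.coassoc, ← AlgHom.comp_assoc, e2, AlgHom.comp_assoc]
  have h1 := DFunLike.congr_fun key s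
  have h2 : Δ (q (act.coaction s)) = 0 := by rw [hq, map_zero]
  exact (Algebra.TensorProduct.assoc R R R (S ⧸ I) H H).injective
    ((h1.trans h2).trans (map_zero _).symm)

theorem isFPrime_core [Module.Flat R H] (P : Ideal S) [P.IsPrime] : act.IsFPrime (act.core P) where
  stable := act.isStable_core P
  ne_top h := (inferInstance : P.IsPrime).ne_top (top_le_iff.1 (h ▸ act.core_le P))
  le_or_le I J hI hJ hIJ :=
    ((Ideal.IsPrime.mul_le ‹_›).1 (hIJ.trans (act.core_le P))).imp (hI.le_core act) (hJ.le_core act)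

/-- The semiinvariants of weight `χ`. -/
def weightSpace (χ : H) : Submodule R S :=
  LinearMap.eqLocus act.coaction.toLinearMap ((TensorProduct.mk R S H).flip χ)

theorem mem_weightSpace {χ : H} {s : S} : s ∈ act.weightSpace χ ↔ act.coaction s = s ⊗ₜ χ :=
  Iff.rfl

theorem isStable_span_of_mem_weightSpace {χ : H} {f : S} (hf : f ∈ act.weightSpace χ) :
    act.IsStable (Ideal.span {f}) := by
  intro a ha
  obtain ⟨b, rfl⟩ := Ideal.mem_span_singleton'.1 ha
  have : f ⊗ₜ[R] χ = f ⊗ₜ[R] (1 : H) * (1 : S) ⊗ₜ[R] χ := by simp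
  rw [map_mul, (act.mem_weightSpace).1 hf, this]
  exact Ideal.mul_mem_left _ _ (Ideal.mul_mem_right _ _
    (Ideal.mem_map_of_mem _ (Ideal.mem_span_singleton_self f)))

/-- Applying `ω` to `a f = 0` and cancelling the unit `χ` gives `ω(a) (f ⊗ 1) = 0`, and flatness
identifies the kernel of multiplication by `f ⊗ 1`. -/
theorem isStable_annihilator_of_mem_weightSpace [Module.Flat R H] {χ : H} (hχ : IsUnit χ) {f : S}
    (hf : f ∈ act.weightSpace χ) : act.IsStable (Submodule.annihilator (Ideal.span {f})) := by
  intro a ha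
  have ha : a * f = 0 := by simpa [Submodule.mem_annihilator_span_singleton] using ha
  refine mem_map_includeLeft_of_rTensor_eq_zero (LinearMap.mulRight R f) _
    (fun s hs ↦ by simpa [Submodule.mem_annihilator_span_singleton] using hs) ?_
  have h1 : ∀ x : S ⊗[R] H, (LinearMap.mulRight R f).rTensor H x = x * f ⊗ₜ 1 := by
    intro x
    induction x with
    | zero => simp
    | add x y hx hy => rw [map_add, hx, hy, add_mul]
    | tmul s h => simp
  obtain ⟨χ', hχ'⟩ := hχ.exists_right_inv
  have h2 : act.coaction a * f ⊗ₜ χ = 0 := by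
    rw [← (act.mem_weightSpace).1 hf, ← map_mul, ha, map_zero]
  have h3 : (f ⊗ₜ[R] (1 : H) : S ⊗[R] H) = f ⊗ₜ χ * 1 ⊗ₜ χ' := by simp [hχ']
  rw [h1, h3, ← mul_assoc, h2, zero_mul]

/-- Nonzero semiinvariants of an `F`-domain are regular. -/
theorem IsFDomain.mem_nonZeroDivisors {act : GroupSchemeAction R H S} (h : act.IsFDomain)
    [Module.Flat R H] {χ : H} (hχ : IsUnit χ) {f : S}
    (hf : f ∈ act.weightSpace χ) (hf0 : f ≠ 0) : f ∈ nonZeroDivisors S := by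
  -- The annihilator of `f` and the ideal `(f)` are stable with product zero.
  have h1 := h.le_or_le _ _ (act.isStable_annihilator_of_mem_weightSpace hχ hf)
    (act.isStable_span_of_mem_weightSpace hf) (by
      have := Submodule.annihilator_smul (Ideal.span {f})
      rw [smul_eq_mul] at this
      exact this.le)
  have h2 : Submodule.annihilator (Ideal.span {f}) ≤ ⊥ :=
    h1.resolve_right fun h ↦ hf0 (by simpa using h)
  rw [mem_nonZeroDivisors_iff_right]
  intro x hx
  exact h2 (by simpa [Submodule.mem_annihilator_span_singleton] using hx)

end Stable

/-! ### Decomposition into weight spaces. -/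

section Grading

variable {R : Type*} [CommRing R] {H : Type*} [CommRing H] [HopfAlgebra R H]
  {S : Type*} [CommRing S] [Algebra R S] {ι : Type*}

/-- The map `(mᵢ) ↦ ∑ mᵢ ⊗ cᵢ`. -/
noncomputable def sumTmul (c : ι → H) (M : Type*) [AddCommGroup M] [Module R M] :
    (ι →₀ M) →ₗ[R] M ⊗[R] H :=
  Finsupp.lsum R fun i ↦ (TensorProduct.mk R M H).flip (c i)

theorem sumTmul_single (c : ι → H) {M : Type*} [AddCommGroup M] [Module R M] (i : ι) (m : M) :
    sumTmul (R := R) c M (Finsupp.single i m) = m ⊗ₜ c i := by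
  simp [sumTmul]

theorem sumTmul_apply (c : ι → H) {M : Type*} [AddCommGroup M] [Module R M] (x : ι →₀ M) :
    sumTmul (R := R) c M x = x.sum fun i m ↦ m ⊗ₜ c i := by
  simp [sumTmul]
  rfl

theorem rTensor_sumTmul (c : ι → H) {M N : Type*} [AddCommGroup M] [Module R M] [AddCommGroup N]
    [Module R N] (g : M →ₗ[R] N) (x : ι →₀ M) :
    g.rTensor H (sumTmul c M x) = sumTmul c N (Finsupp.mapRange.linearMap g x) := by
  induction x using Finsupp.induction_linear with
  | zero => simp
  | add x y hx hy => simp only [map_add, hx, hy]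
  | single i m => simp [sumTmul_single]

variable (act : GroupSchemeAction R H S) {c : ι → H}

theorem sum_eq_of_coaction_eq_sumTmul (hc : ∀ i, IsGroupLikeElem R (c i)) {s : S} {x : ι →₀ S}
    (hx : act.coaction s = sumTmul c S x) : (x.sum fun _ a ↦ a) = s := by
  have h1 := DFunLike.congr_fun act.counit s
  rw [AlgHom.comp_apply, hx, sumTmul_apply, Finsupp.sum, map_sum] at h1
  have h2 := congrArg (Algebra.TensorProduct.rid R R S) h1
  simpa [map_sum, (hc _).counit_eq_one, Finsupp.sum] using h2

/-- Coassociativity reads `∑ ω(xᵢ) ⊗ cᵢ = ∑ (xᵢ ⊗ cᵢ) ⊗ cᵢ`; injectivity over `S ⊗ H` allows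
comparing coefficients of `cᵢ`. -/
theorem mem_weightSpace_of_coaction_eq_sumTmul (hc : ∀ i, IsGroupLikeElem R (c i))
    (hinj : Function.Injective (sumTmul (R := R) c (S ⊗[R] H)))
    {s : S} {x : ι →₀ S} (hx : act.coaction s = sumTmul c S x) (i : ι) :
    x i ∈ act.weightSpace (c i) := by
  have h1 := DFunLike.congr_fun act.coassoc s
  simp only [AlgHom.comp_apply, hx] at h1
  have h2 : ∀ y : ι →₀ S, Algebra.TensorProduct.map act.coaction (AlgHom.id R H) (sumTmul c S y) =
      sumTmul c (S ⊗[R] H) (Finsupp.mapRange.linearMap act.coaction.toLinearMap y) :=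
    rTensor_sumTmul c act.coaction.toLinearMap
  let D : (ι →₀ S) →ₗ[R] (ι →₀ S ⊗[R] H) :=
    Finsupp.lsum R fun i ↦ (Finsupp.lsingle i).comp ((TensorProduct.mk R S H).flip (c i))
  have hD : ∀ i a, D (Finsupp.single i a) = Finsupp.single i (a ⊗ₜ c i) := by simp [D]
  have hDi : ∀ y i, D y i = y i ⊗ₜ c i := by
    classical
    intro y i
    induction y using Finsupp.induction_linear with
    | zero => simp
    | add x y hx hy => simp only [map_add, Finsupp.add_apply, hx, hy, TensorProduct.add_tmul]
    | single j m =>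
      rw [hD, Finsupp.single_apply, Finsupp.single_apply]
      split_ifs with h
      · rw [h]
      · simp
  have h3 : ∀ y : ι →₀ S, Algebra.TensorProduct.map (AlgHom.id R S) (Bialgebra.comulAlgHom R H)
      (sumTmul c S y) = Algebra.TensorProduct.assoc R R R S H H (sumTmul c (S ⊗[R] H) (D y)) := by
    intro y
    induction y using Finsupp.induction_linear with
    | zero => simp
    | add x y hx hy => simp only [map_add, hx, hy]
    | single i m => simp [hD, sumTmul_single, (hc i).comul_eq_tmul_self]
  rw [h2, h3] at h1
  have h4 := hinj ((Algebra.TensorProduct.assoc R R R S H H).injective h1)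
  have h5 := DFunLike.congr_fun h4 i
  rw [hDi] at h5
  exact h5

variable {act} in
theorem mul_mem_weightSpace {χ χ' : H} {s t : S} (hs : s ∈ act.weightSpace χ)
    (ht : t ∈ act.weightSpace χ') : s * t ∈ act.weightSpace (χ * χ') := by
  rw [mem_weightSpace] at *
  rw [map_mul, hs, ht, Algebra.TensorProduct.tmul_mul_tmul]

theorem one_mem_weightSpace : (1 : S) ∈ act.weightSpace 1 := by
  rw [mem_weightSpace, map_one]
  rfl

/-- The homogeneous components of a subalgebra spanned by semiinvariants with weights `c i`. -/
def gradedPiece (A : Subalgebra R S) (c : ι → H) (i : ι) : Submodule R A :=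
  (act.weightSpace (c i)).comap A.val.toLinearMap

/-- The coaction of a sum of weight vectors determines them, whence independence. Conversely the
coefficients of `ω(s)` are weight vectors, and the counit shows that they add up to `s`. -/
theorem isInternal_gradedPiece [DecidableEq ι] (hc : ∀ i, IsGroupLikeElem R (c i))
    (hinjS : Function.Injective (sumTmul (R := R) c S))
    (hinj : Function.Injective (sumTmul (R := R) c (S ⊗[R] H)))
    (A : Subalgebra R S) (hA : ∀ i, ∀ s ∈ act.weightSpace (c i), s ∈ A)
    (hA' : ∀ s ∈ A, act.coaction s ∈ LinearMap.range (sumTmul (R := R) c S)) :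
    DirectSum.IsInternal (act.gradedPiece A c) := by
  constructor
  · rw [injective_iff_map_eq_zero]
    intro x hx
    let T : (DirectSum ι fun i ↦ act.gradedPiece A c i) →+ (ι →₀ S) :=
      DirectSum.toAddMonoid fun i ↦ (Finsupp.singleAddHom i).comp
        (A.val.toLinearMap.comp (act.gradedPiece A c i).subtype).toAddMonoidHom
    have hT : ∀ i a, T (DirectSum.of _ i a) = Finsupp.single i ((a : A) : S) := by
      intro i a
      exact DirectSum.toAddMonoid_of _ _ _
    have hTi : ∀ x i, T x i = ((x i : A) : S) := by
      intro x i
      induction x using DirectSum.induction_on with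
      | zero => simp
      | add x y hx hy => simp [hx, hy]
      | of j a =>
        rw [hT, DirectSum.of_apply, Finsupp.single_apply]
        split_ifs with h
        · subst h; rfl
        · rfl
    have h1 : ∀ x, sumTmul c S (T x) =
        act.coaction (A.val (DirectSum.coeAddMonoidHom (act.gradedPiece A c) x)) := by
      intro x
      induction x using DirectSum.induction_on with
      | zero => simp
      | add x y hx hy => simp only [map_add, hx, hy]
      | of j a =>
        rw [hT, sumTmul_single, DirectSum.coeAddMonoidHom_of]
        exact a.2.symm
    have h2 := h1 x
    rw [hx, map_zero, map_zero] at h2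
    have h3 : T x = 0 := hinjS (h2.trans (map_zero _).symm)
    ext i
    rw [← hTi, h3]
    rfl
  · intro s
    obtain ⟨x, hx⟩ := hA' s s.2
    have hw := act.mem_weightSpace_of_coaction_eq_sumTmul hc hinj hx.symm
    refine ⟨∑ i ∈ x.support, DirectSum.of (fun i ↦ act.gradedPiece A c i) i
      ⟨⟨x i, hA i _ (hw i)⟩, hw i⟩, Subtype.ext ?_⟩
    rw [map_sum]
    simp only [DirectSum.coeAddMonoidHom_of]
    rw [AddSubmonoidClass.coe_finsetSum]
    exact act.sum_eq_of_coaction_eq_sumTmul hc hx.symm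

/-- A subalgebra spanned by semiinvariants is graded by their weights. -/
theorem nonempty_gradedRing_gradedPiece [AddMonoid ι] [LinearOrder ι]
    (hc : ∀ i, IsGroupLikeElem R (c i)) (hc0 : c 0 = 1) (hcadd : ∀ i j, c (i + j) = c i * c j)
    (hinjS : Function.Injective (sumTmul (R := R) c S))
    (hinj : Function.Injective (sumTmul (R := R) c (S ⊗[R] H)))
    (A : Subalgebra R S) (hA : ∀ i, ∀ s ∈ act.weightSpace (c i), s ∈ A)
    (hA' : ∀ s ∈ A, act.coaction s ∈ LinearMap.range (sumTmul (R := R) c S)) :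
    Nonempty (GradedRing (act.gradedPiece A c)) := by
  have h1 : SetLike.GradedOne (act.gradedPiece A c) :=
    ⟨by
      change (1 : S) ∈ act.weightSpace (c 0)
      rw [hc0]
      exact act.one_mem_weightSpace⟩
  have h2 : SetLike.GradedMul (act.gradedPiece A c) :=
    ⟨fun {i j gi gj} hi hj ↦ by
      change (gi : S) * gj ∈ act.weightSpace (c (i + j))
      rw [hcadd]
      exact mul_mem_weightSpace hi hj⟩
  have h3 := (act.isInternal_gradedPiece hc hinjS hinj A hA hA').chooseDecomposition
  exact ⟨{ one_mem := h1.one_mem, mul_mem := h2.mul_mem, toDecomposition := h3 }⟩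

end Grading

end GroupSchemeAction

namespace GroupSchemeAction

/-! ### The action of points of the group scheme. -/

section Points

variable {R : Type*} [CommRing R] {H : Type*} [CommRing H] [HopfAlgebra R H]
  {S : Type*} [CommRing S] [Algebra R S] (act : GroupSchemeAction R H S)
  {E : Type*} [CommRing E] [Algebra R E]

open WithConv in
-- By coassociativity `y * x` acts by `x` first and then `y`, so a point `x` fixing `s` drops out.
theorem map_convMul_coaction (y x : WithConv (H →ₐ[R] E)) {s : S}
    (hx : Algebra.TensorProduct.map (AlgHom.id R S) x.ofConv (act.coaction s) = s ⊗ₜ 1) :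
    Algebra.TensorProduct.map (AlgHom.id R S) (y * x).ofConv (act.coaction s) =
      Algebra.TensorProduct.map (AlgHom.id R S) y.ofConv (act.coaction s) := by
  let μ := Algebra.TensorProduct.map (AlgHom.id R S) (Algebra.TensorProduct.lmul' R (S := E))
  let α := (Algebra.TensorProduct.map (AlgHom.id R S) y.ofConv).comp act.coaction
  have e1 : Algebra.TensorProduct.map (AlgHom.id R S) (y * x).ofConv =
      (μ.comp (Algebra.TensorProduct.map (AlgHom.id R S)
        (Algebra.TensorProduct.map y.ofConv x.ofConv))).comp
        (Algebra.TensorProduct.map (AlgHom.id R S) (Bialgebra.comulAlgHom R H)) := by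
    simp only [μ, ← Algebra.TensorProduct.map_comp]
    rfl
  have e2 : (Algebra.TensorProduct.map (AlgHom.id R S)
        (Algebra.TensorProduct.map y.ofConv x.ofConv)).comp
        ((Algebra.TensorProduct.assoc R R R S H H).toAlgHom.comp
          (Algebra.TensorProduct.map act.coaction (AlgHom.id R H))) =
      (Algebra.TensorProduct.assoc R R R S E E).toAlgHom.comp
        ((Algebra.TensorProduct.map α (AlgHom.id R E)).comp
          (Algebra.TensorProduct.map (AlgHom.id R S) x.ofConv)) := by
    have e3 : (Algebra.TensorProduct.map (AlgHom.id R S)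
        (Algebra.TensorProduct.map y.ofConv x.ofConv)).comp
        (Algebra.TensorProduct.assoc R R R S H H).toAlgHom =
        (Algebra.TensorProduct.assoc R R R S E E).toAlgHom.comp
          (Algebra.TensorProduct.map
            (Algebra.TensorProduct.map (AlgHom.id R S) y.ofConv) x.ofConv) := by
      ext <;> simp [Algebra.TensorProduct.one_def]
    rw [← AlgHom.comp_assoc, e3, AlgHom.comp_assoc, ← Algebra.TensorProduct.map_comp,
      ← Algebra.TensorProduct.map_comp]
    rfl
  have h1 := DFunLike.congr_fun act.coassoc s
  have h2 := DFunLike.congr_fun e2 (act.coaction s)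
  simp only [AlgHom.comp_apply] at h1 h2
  rw [e1, AlgHom.comp_apply, AlgHom.comp_apply, ← h1, h2, hx, Algebra.TensorProduct.map_tmul]
  have h3 : ∀ t : S ⊗[R] E,
      μ ((Algebra.TensorProduct.assoc R R R S E E).toAlgHom (t ⊗ₜ (1 : E))) = t := by
    intro t
    induction t with
    | zero => simp
    | add a b ha hb => rw [TensorProduct.add_tmul, map_add, map_add, ha, hb]
    | tmul a b => simp [μ]
  exact h3 _

end Points

/-! ### Descent along the quotient map `F → T`. -/

section Torsor

variable {R : Type u} [CommRing R] {HN HF HT : Type u} [CommRing HN] [HopfAlgebra R HN]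
  [CommRing HF] [HopfAlgebra R HF] [CommRing HT] [HopfAlgebra R HT]
  {φ : HF →ₐc[R] HN} {ψ : HT →ₐc[R] HF}
  {S : Type v} [CommRing S] [Algebra R S] (act : GroupSchemeAction R HF S)

open WithConv in
theorem convMul_comp_antipode {H E : Type*} [CommRing H] [HopfAlgebra R H] [CommRing E]
    [Algebra R E] (y : H →ₐ[R] E) :
    toConv y * toConv (y.comp (HopfAlgebra.antipodeAlgHom R H)) = 1 ∧
      toConv (y.comp (HopfAlgebra.antipodeAlgHom R H)) * toConv y = 1 := by
  have h1 : (toConv (AlgHom.id R H)) * (toConv (AlgHom.id R H))⁻¹ = 1 := mul_inv_cancel _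
  have h2 : (toConv (AlgHom.id R H))⁻¹ * (toConv (AlgHom.id R H)) = 1 := inv_mul_cancel _
  have h3 : toConv (y.comp (1 : WithConv (H →ₐ[R] H)).ofConv) = 1 := by
    apply WithConv.ofConv_injective
    ext t
    simp [AlgHom.convOne_def, Algebra.ofId_apply]
  constructor
  · rw [← h3, ← h1, AlgHom.comp_convMul_distrib]
    rfl
  · rw [← h3, ← h2, AlgHom.comp_convMul_distrib]
    rfl

open WithConv in
/-- On `N`-invariants, points of `F` with the same image in `F / N` act in the same way. -/
theorem map_coaction_eq_of_comp_eq (h : IsShortExactGroupSchemes φ ψ)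
    {E : Type u} [CommRing E] [Algebra R E]
    {y₁ y₂ : HF →ₐ[R] E} (hy : y₁.comp (ψ : HT →ₐ[R] HF) = y₂.comp (ψ : HT →ₐ[R] HF)) {s : S}
    (hs : s ∈ (act.restrict φ).invariants) :
    Algebra.TensorProduct.map (AlgHom.id R S) y₁ (act.coaction s) =
      Algebra.TensorProduct.map (AlgHom.id R S) y₂ (act.coaction s) := by
  let z : WithConv (HF →ₐ[R] E) := toConv (y₁.comp (HopfAlgebra.antipodeAlgHom R HF))
  -- The point `y₁⁻¹ y₂` dies in `T`, hence comes from `N` and fixes `s`.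
  let x : WithConv (HF →ₐ[R] E) := z * toConv y₂
  have hx : x.ofConv.comp (ψ : HT →ₐ[R] HF) =
      (Algebra.ofId R E).comp (Bialgebra.counitAlgHom R HT) := by
    have h1 := AlgHom.convMul_comp_bialgHom_distrib z (toConv y₂) ψ
    have h2 := AlgHom.convMul_comp_bialgHom_distrib z (toConv y₁) ψ
    rw [(convMul_comp_antipode y₁).2] at h2
    refine h1.trans ?_
    simp only at h2 ⊢
    rw [← hy, ← h2]
    ext t
    simp [AlgHom.convOne_def, Algebra.ofId_apply]
  obtain ⟨x', hx'⟩ := (h.exact E x.ofConv).2 hx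
  have h3 : Algebra.TensorProduct.map (AlgHom.id R S) x.ofConv (act.coaction s) = s ⊗ₜ 1 := by
    have h4 : (act.restrict φ).coaction s = s ⊗ₜ 1 := hs
    have h5 : Algebra.TensorProduct.map (AlgHom.id R S) x.ofConv =
        (Algebra.TensorProduct.map (AlgHom.id R S) x').comp
          (Algebra.TensorProduct.map (AlgHom.id R S) (φ : HF →ₐ[R] HN)) := by
      rw [← Algebra.TensorProduct.map_comp, hx']
      rfl
    rw [h5, AlgHom.comp_apply]
    change Algebra.TensorProduct.map (AlgHom.id R S) x' ((act.restrict φ).coaction s) = _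
    rw [h4, Algebra.TensorProduct.map_tmul, map_one]
    rfl
  have h6 : toConv y₁ * x = toConv y₂ := by
    rw [← mul_assoc, (convMul_comp_antipode y₁).1, one_mul]
  have h7 := act.map_convMul_coaction (toConv y₁) x h3
  rw [h6] at h7
  exact h7.symm

/-- Up to isomorphism this is the map from the `A`-module `A ⊗ M` to its faithfully flat base change
to `B`. -/
theorem lTensor_injective_of_faithfullyFlat {R A B : Type*} [CommRing R] [CommRing A] [CommRing B]
    [Algebra R A] [Algebra R B] [Algebra A B] [IsScalarTower R A B] [Module.FaithfullyFlat A B]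
    (M : Type*) [AddCommGroup M] [Module R M] :
    Function.Injective ((IsScalarTower.toAlgHom R A B).toLinearMap.lTensor M) := by
  have h1 := Module.FaithfullyFlat.tensorProduct_mk_injective (A := A) (B := B) (A ⊗[R] M)
  have h2 : ∀ t : M ⊗[R] A, TensorProduct.AlgebraTensorModule.cancelBaseChange R A A B M
      (1 ⊗ₜ TensorProduct.comm R M A t) =
      TensorProduct.comm R M B ((IsScalarTower.toAlgHom R A B).toLinearMap.lTensor M t) := by
    intro t
    induction t with
    | zero => simp
    | add a b ha hb => simp only [map_add, TensorProduct.tmul_add, ha, hb]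
    | tmul m a => simp [Algebra.smul_def]
  intro t t' htt
  apply (TensorProduct.comm R M A).injective
  apply h1
  apply (TensorProduct.AlgebraTensorModule.cancelBaseChange R A A B M).injective
  exact (h2 t).trans ((congrArg _ htt).trans (h2 t').symm)

/-- The quotient map `F → F / N` is faithfully flat, so that `M ⊗ R[F / N]` embeds into
`M ⊗ R[F]`. -/
theorem lTensor_injective_of_isShortExact (h : IsShortExactGroupSchemes φ ψ)
    (M : Type*) [AddCommGroup M] [Module R M] :
    Function.Injective ((ψ : HT →ₐ[R] HF).toLinearMap.lTensor M) := by
  -- Lifting the universal point of `T` factors the faithfully flat map `R[T] → C` through `ψ`.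
  obtain ⟨C, _, _, _, _, y, hC, -, hy⟩ := h.locally_surjective HT (AlgHom.id R HT)
  have h1 := lTensor_injective_of_faithfullyFlat (R := R) (A := HT) (B := C) M
  rw [AlgHom.comp_id] at hy
  rw [← hy, AlgHom.comp_toLinearMap, LinearMap.lTensor_comp, LinearMap.coe_comp] at h1
  exact h1.of_comp

/-- The coaction of `F` maps the invariants of `N` into `S ⊗ R[F / N]`. -/
theorem coaction_mem_range_of_mem_invariants (h : IsShortExactGroupSchemes φ ψ) {s : S}
    (hs : s ∈ (act.restrict φ).invariants) :
    act.coaction s ∈ LinearMap.range ((ψ : HT →ₐ[R] HF).toLinearMap.lTensor S) := by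
  obtain ⟨C, _, _, _, _, y, hC, -, hy⟩ := h.locally_surjective HT (AlgHom.id R HT)
  rw [AlgHom.comp_id] at hy
  let : Algebra HT HF := (ψ : HT →ₐ[R] HF).toRingHom.toAlgebra
  have : IsScalarTower R HT HF :=
    IsScalarTower.of_algebraMap_eq' (ψ : HT →ₐ[R] HF).comp_algebraMap.symm
  -- The lift over `C` and the universal point of `F` become two points over `C ⊗ R[F]` with the
  -- same image in `T`. The first visibly acts through `C`.
  let y₁ : HF →ₐ[R] C ⊗[HT] HF :=
    ((Algebra.TensorProduct.includeLeft : C →ₐ[HT] C ⊗[HT] HF).restrictScalars R).comp y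
  let y₂ : HF →ₐ[R] C ⊗[HT] HF :=
    (Algebra.TensorProduct.includeRight : HF →ₐ[HT] C ⊗[HT] HF).restrictScalars R
  have hy12 : y₁.comp (ψ : HT →ₐ[R] HF) = y₂.comp (ψ : HT →ₐ[R] HF) := by
    ext t
    have h1 : y (ψ t) = algebraMap HT C t := DFunLike.congr_fun hy t
    change (y (ψ t)) ⊗ₜ[HT] (1 : HF) = (1 : C) ⊗ₜ[HT] (algebraMap HT HF t)
    rw [h1, Algebra.algebraMap_eq_smul_one, Algebra.algebraMap_eq_smul_one,
      TensorProduct.smul_tmul]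
  have key := act.map_coaction_eq_of_comp_eq h hy12 hs
  let Ψ : HT ⊗[R] S →ₗ[HT] HF ⊗[R] S :=
    TensorProduct.AlgebraTensorModule.map (Algebra.linearMap HT HF) LinearMap.id
  let θ := TensorProduct.AlgebraTensorModule.assoc R HT HT C HF S
  have h1 : ∀ t : S ⊗[R] HF, θ (TensorProduct.comm R S _
      (Algebra.TensorProduct.map (AlgHom.id R S) y₂ t)) = 1 ⊗ₜ TensorProduct.comm R S HF t := by
    intro t
    induction t with
    | zero => simp
    | add a b ha hb => simp only [map_add, TensorProduct.tmul_add, ha, hb]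
    | tmul a b => rfl
  have h2 : ∀ t : S ⊗[R] HF, θ (TensorProduct.comm R S _
      (Algebra.TensorProduct.map (AlgHom.id R S) y₁ t)) ∈ LinearMap.range (Ψ.lTensor C) := by
    intro t
    induction t with
    | zero => simp
    | add a b ha hb => simp only [map_add]; exact add_mem ha hb
    | tmul a b =>
      refine ⟨y b ⊗ₜ (1 ⊗ₜ a), ?_⟩
      change y b ⊗ₜ[HT] (algebraMap HT HF 1 ⊗ₜ[R] a) = y b ⊗ₜ[HT] ((1 : HF) ⊗ₜ[R] a)
      rw [map_one]
  have h3 : (1 : C) ⊗ₜ[HT] TensorProduct.comm R S HF (act.coaction s) ∈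
      LinearMap.range (Ψ.lTensor C) := by
    rw [← h1, ← key]
    exact h2 _
  -- Faithfully flat descent: the class modulo the range of `Ψ` vanishes after base change to `C`.
  have h4 : TensorProduct.comm R S HF (act.coaction s) ∈ LinearMap.range Ψ := by
    rw [← Submodule.Quotient.mk_eq_zero]
    apply Module.FaithfullyFlat.tensorProduct_mk_injective (A := HT) (B := C)
      ((HF ⊗[R] S) ⧸ LinearMap.range Ψ)
    obtain ⟨z, hz⟩ := h3
    have h5 := congrArg ((LinearMap.range Ψ).mkQ.lTensor C) hz
    rw [← LinearMap.comp_apply, ← LinearMap.lTensor_comp, LinearMap.range_mkQ_comp,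
      LinearMap.lTensor_zero, LinearMap.zero_apply, LinearMap.lTensor_tmul] at h5
    rw [map_zero]
    exact h5.symm
  obtain ⟨z, hz⟩ := h4
  refine ⟨TensorProduct.comm R HT S z, (TensorProduct.comm R S HF).injective ?_⟩
  rw [← hz]
  clear hz
  induction z with
  | zero => simp
  | add a b ha hb => simp only [map_add, ha, hb]
  | tmul a b => rfl

end Torsor

end GroupSchemeAction

namespace GroupSchemeAction

/-! ### Group-like bases and the proof of (1). -/

section Basis

variable {R : Type*} [CommRing R] {K H : Type*} [AddCommGroup K] [Module R K] [CommRing H]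
  [HopfAlgebra R H] {ι : Type*} [DecidableEq ι]

theorem lTensor_equivFinsuppOfBasisRight_symm (b : Module.Basis ι R K) (ψ : K →ₗ[R] H)
    (M : Type*) [AddCommGroup M] [Module R M] (x : ι →₀ M) :
    ψ.lTensor M ((TensorProduct.equivFinsuppOfBasisRight b).symm x) =
      sumTmul (fun i ↦ ψ (b i)) M x := by
  induction x using Finsupp.induction_linear with
  | zero => simp
  | add x y hx hy => simp only [map_add, hx, hy]
  | single i m => simp [sumTmul_single]

theorem sumTmul_injective_of_basis (b : Module.Basis ι R K) (ψ : K →ₗ[R] H)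
    (M : Type*) [AddCommGroup M] [Module R M] (h : Function.Injective (ψ.lTensor M)) :
    Function.Injective (sumTmul (R := R) (fun i ↦ ψ (b i)) M) := by
  have h1 := h.comp (TensorProduct.equivFinsuppOfBasisRight (M := M) b).symm.injective
  convert h1 using 1
  ext1 x
  exact (lTensor_equivFinsuppOfBasisRight_symm b ψ M x).symm

theorem range_sumTmul_of_basis (b : Module.Basis ι R K) (ψ : K →ₗ[R] H)
    (M : Type*) [AddCommGroup M] [Module R M] :
    LinearMap.range (sumTmul (R := R) (fun i ↦ ψ (b i)) M) = LinearMap.range (ψ.lTensor M) := by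
  ext t
  constructor
  · rintro ⟨x, rfl⟩
    exact ⟨_, lTensor_equivFinsuppOfBasisRight_symm b ψ M x⟩
  · rintro ⟨z, rfl⟩
    refine ⟨TensorProduct.equivFinsuppOfBasisRight b z, ?_⟩
    rw [← lTensor_equivFinsuppOfBasisRight_symm, LinearEquiv.symm_apply_apply]

end Basis

instance finite_int_lex_pi (n : ℕ) : Module.Finite ℤ (Lex (Fin n → ℤ)) := by
  let f : (Fin n → ℤ) →+ Lex (Fin n → ℤ) :=
    { toFun := toLex, map_zero' := rfl, map_add' := fun _ _ ↦ rfl }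
  exact Module.Finite.of_surjective f.toIntLinearMap toLex.surjective

section InvariantsDiv

variable {R : Type*} [CommRing R] {H : Type*} [CommRing H] [HopfAlgebra R H]
  {S : Type*} [CommRing S] [Algebra R S] (act : GroupSchemeAction R H S)

/-- Multiplication by `f ⊗ 1` stays injective on `S ⊗ H` by flatness, so it can be cancelled from
`ω(f s) = f s ⊗ 1`. -/
theorem mem_invariants_of_mul_mem [Module.Flat R H] {f s : S} (hf : f ∈ act.invariants)
    (hreg : f ∈ nonZeroDivisors S) (hfs : f * s ∈ act.invariants) : s ∈ act.invariants := by
  have h1 : act.coaction f = f ⊗ₜ 1 := hf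
  have h2 : act.coaction (f * s) = (f * s) ⊗ₜ 1 := hfs
  have hinj : Function.Injective ((LinearMap.mulLeft R f).rTensor H) := by
    refine Module.Flat.rTensor_preserves_injective_linearMap _ fun a b hab ↦ ?_
    exact (mul_cancel_left_mem_nonZeroDivisors hreg).1 hab
  have h3 : ∀ x : S ⊗[R] H, (LinearMap.mulLeft R f).rTensor H x = f ⊗ₜ 1 * x := by
    intro x
    induction x with
    | zero => simp
    | add x y hx hy => rw [map_add, hx, hy, mul_add]
    | tmul s h => simp
  change act.coaction s = s ⊗ₜ 1
  apply hinj
  rw [h3, h3, ← h1, ← map_mul, h2, h1, Algebra.TensorProduct.tmul_mul_tmul, one_mul]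

end InvariantsDiv

section Invariants

variable {R : Type u} [CommRing R] {HN HF HT : Type u} [CommRing HN] [HopfAlgebra R HN]
  [CommRing HF] [HopfAlgebra R HF] [CommRing HT] [HopfAlgebra R HT]
  {φ : HF →ₐc[R] HN} {ψ : HT →ₐc[R] HF}

theorem isDomain_and_uniqueFactorizationMonoid_invariants [Module.Flat R HN] [Module.Flat R HF]
    (h : IsShortExactGroupSchemes φ ψ) (n : ℕ) (e : HT ≃ₐc[R] AddMonoidAlgebra R (Fin n → ℤ))
    {S : Type v} [CommRing S] [Algebra R S] [IsNoetherianRing S]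
    (act : GroupSchemeAction R HF S) (hdom : act.IsFDomain)
    (hprin : ∀ P : Ideal S, act.IsFPrime P → P.height = 1 →
      PrincipalContractionIfMinimal (act.restrict φ).invariants P) :
    IsDomain (act.restrict φ).invariants ∧
      UniqueFactorizationMonoid (act.restrict φ).invariants := by
  -- The lexicographic order makes ℤⁿ a linearly ordered group, as the homogeneous prime arguments
  -- need.
  let g : Lex (Fin n → ℤ) → HT := fun i ↦ e.symm (AddMonoidAlgebra.single (ofLex i) 1)
  let b : Module.Basis (Lex (Fin n → ℤ)) R HT :=
    ((Module.Basis.ofRepr (AddMonoidAlgebra.coeffLinearEquiv R)).map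
      (e.symm : AddMonoidAlgebra R (Fin n → ℤ) ≃ₐ[R] HT).toLinearEquiv).reindex toLex
  have hb : ∀ i, b i = g i := by
    intro i
    simp [b, g]
  let c : Lex (Fin n → ℤ) → HF := fun i ↦ ψ (g i)
  have hcb : c = fun i ↦ (ψ : HT →ₐ[R] HF).toLinearMap (b i) := by
    funext i
    rw [hb]
    rfl
  have hg : ∀ i, IsGroupLikeElem R (g i) := fun i ↦
    (AddMonoidAlgebra.isGroupLikeElem_single_one (R := R) (A := R) (ofLex i)).map e.symm
  have hc : ∀ i, IsGroupLikeElem R (c i) := fun i ↦ (hg i).map ψ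
  have hc0 : c 0 = 1 := by
    have : g 0 = 1 := map_one e.symm
    simp only [c, this, map_one]
  have hcadd : ∀ i j, c (i + j) = c i * c j := by
    intro i j
    have : g (i + j) = g i * g j := by
      simp only [g, ← map_mul, AddMonoidAlgebra.single_mul_single, mul_one]
      rfl
    simp only [c, this, map_mul]
  have hinj : ∀ (M : Type (max u v)) [AddCommGroup M] [Module R M],
      Function.Injective (sumTmul (R := R) c M) := fun M _ _ ↦ by
    rw [hcb]
    exact sumTmul_injective_of_basis b _ M (lTensor_injective_of_isShortExact h M)
  have hinjS : Function.Injective (sumTmul (R := R) c S) := by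
    rw [hcb]
    exact sumTmul_injective_of_basis b _ S (lTensor_injective_of_isShortExact h S)
  let A := (act.restrict φ).invariants
  have hψφ : ∀ t, φ (ψ t) = algebraMap R HN (Coalgebra.counit t) := by
    intro t
    have := (h.exact HN (φ : HF →ₐ[R] HN)).1 ⟨AlgHom.id R HN, AlgHom.id_comp _⟩
    exact DFunLike.congr_fun this t
  have hA : ∀ i, ∀ s ∈ act.weightSpace (c i), s ∈ A := by
    intro i s hs
    have h1 : φ (c i) = 1 := by
      rw [hψφ, (hg i).counit_eq_one, map_one]
    change Algebra.TensorProduct.map (AlgHom.id R S) (φ : HF →ₐ[R] HN) (act.coaction s) = s ⊗ₜ 1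
    rw [(act.mem_weightSpace).1 hs, Algebra.TensorProduct.map_tmul]
    exact congrArg _ h1
  have hA' : ∀ s ∈ A, act.coaction s ∈ LinearMap.range (sumTmul (R := R) c S) := by
    intro s hs
    rw [hcb, range_sumTmul_of_basis]
    exact act.coaction_mem_range_of_mem_invariants h hs
  obtain ⟨_⟩ := act.nonempty_gradedRing_gradedPiece hc hc0 hcadd hinjS (hinj _) A hA hA'
  have : Nontrivial S := by
    rw [nontrivial_iff_exists_ne (0 : S)]
    by_contra! h0
    exact hdom.ne_top ((Ideal.eq_top_iff_one _).2 (h0 1))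
  have hreg : ∀ i, ∀ f ∈ act.gradedPiece A c i, f ≠ 0 → (f : S) ∈ nonZeroDivisors S :=
    fun i f hf hf0 ↦ hdom.mem_nonZeroDivisors (hc i).isUnit hf fun h ↦ hf0 (Subtype.ext h)
  refine isDomain_and_uniqueFactorizationMonoid_of_principalContraction A (act.gradedPiece A c)
    hreg ?_ ?_
  · intro i f hf hf0 s hs
    exact mem_invariants_of_mul_mem _ f.2 (hreg i f hf hf0) hs
  · intro i f hf hf0 𝔭 h𝔭
    have : 𝔭.IsPrime := h𝔭.1.1
    -- A semiinvariant of `𝔭` generates a stable ideal, so it already lies in the core.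
    refine ⟨act.core 𝔭, act.core_le 𝔭, ?_, fun hP ↦ hprin _ (act.isFPrime_core 𝔭) hP⟩
    intro j g hg hg𝔭
    exact (act.isStable_span_of_mem_weightSpace hg).le_core act
      ((Ideal.span_singleton_le_iff_mem _).2 hg𝔭) (Ideal.mem_span_singleton_self _)

end Invariants

end GroupSchemeAction

/-! ### Smooth algebras over fields are reduced. -/

section Reduced

/-- Integral closure commutes with smooth base change. The nilpotent `s ⊗ t⁻¹` is integral over `S`,
hence comes from `S ⊗ R = S`. -/
theorem IsNilpotent.exists_eq_smul_of_smooth {R S : Type*} [CommRing R] [IsDomain R]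
    [IsIntegrallyClosed R] [CommRing S] [Algebra R S] [Algebra.Smooth R S] {s : S}
    (hs : IsNilpotent s) {t : R} (ht : t ≠ 0) : ∃ z : S, s = t • z := by
  let w : FractionRing R := (algebraMap R (FractionRing R) t)⁻¹
  have hx : IsIntegral S (s ⊗ₜ[R] w) := by
    obtain ⟨n, hn⟩ := hs
    refine IsIntegral.of_pow n.succ_pos ?_
    rw [Algebra.TensorProduct.tmul_pow, show s ^ (n + 1) = 0 by rw [_root_.pow_succ, hn, zero_mul],
      TensorProduct.zero_tmul]
    exact isIntegral_zero
  obtain ⟨y, hy⟩ := (TensorProduct.toIntegralClosure_bijective_of_smooth (R := R) (S := S)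
    (B := FractionRing R)).2 ⟨_, hx⟩
  have hrange : ∀ y : S ⊗[R] integralClosure R (FractionRing R), ∃ z : S,
      (TensorProduct.toIntegralClosure R S (FractionRing R) y : S ⊗[R] FractionRing R) =
        z ⊗ₜ 1 := by
    intro y
    induction y with
    | zero => exact ⟨0, by simp⟩
    | add a b ha hb =>
      obtain ⟨z, hz⟩ := ha
      obtain ⟨z', hz'⟩ := hb
      exact ⟨z + z', by rw [map_add, TensorProduct.add_tmul, ← hz, ← hz']; rfl⟩
    | tmul a b =>
      obtain ⟨r, hr⟩ := IsIntegrallyClosed.isIntegral_iff.1 b.2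
      refine ⟨r • a, ?_⟩
      rw [TensorProduct.smul_tmul, ← Algebra.algebraMap_eq_smul_one, hr]
      rfl
  obtain ⟨z, hz⟩ := hrange y
  rw [hy] at hz
  have h1 : s ⊗ₜ[R] (1 : FractionRing R) = (t • z) ⊗ₜ[R] (1 : FractionRing R) := by
    have h2 : t • (s ⊗ₜ[R] w) = t • (z ⊗ₜ[R] (1 : FractionRing R)) := congrArg _ hz
    rw [← TensorProduct.tmul_smul, TensorProduct.smul_tmul', Algebra.smul_def,
      mul_inv_cancel₀ (by simpa using ht)] at h2
    exact h2
  have h2 := Module.Flat.lTensor_preserves_injective_linearMap (M := S)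
    (Algebra.linearMap R (FractionRing R)) (IsFractionRing.injective R (FractionRing R))
  refine ⟨z, (TensorProduct.rid R S).symm.injective (h2 ?_)⟩
  simpa [TensorProduct.smul_tmul'] using h1

open Polynomial in
/-- Smooth algebras over fields are reduced. -/
theorem isReduced_of_smooth (K S : Type*) [Field K] [CommRing S] [Algebra K S]
    [Algebra.Smooth K S] : IsReduced S := by
  refine ⟨fun s hs ↦ ?_⟩
  have h1 : IsNilpotent ((1 : K[X]) ⊗ₜ[K] s) :=
    hs.map (Algebra.TensorProduct.includeRight : S →ₐ[K] K[X] ⊗[K] S)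
  -- A nilpotent constant in `K[X] ⊗ S` is divisible by `X`, and setting `X = 0` kills it.
  obtain ⟨z, hz⟩ := h1.exists_eq_smul_of_smooth (R := K[X]) X_ne_zero
  let ev : K[X] ⊗[K] S →ₐ[K] S := Algebra.TensorProduct.lift
    ((Algebra.ofId K S).comp (Polynomial.aeval (0 : K))) (AlgHom.id K S) (fun _ _ ↦ .all _ _)
  have h2 := congrArg ev hz
  rw [Algebra.smul_def, map_mul] at h2
  simpa [ev] using h2

end Reduced

/-! ### Geometric connectedness. -/

section Connected

variable {k A L : Type*} [Field k] [CommRing A] [Algebra k A] [Field L] [Algebra k L]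

/-- Over a rational point the fibre of `Spec (A ⊗ L) → Spec A` is `Spec L`, a single point. -/
theorem eq_ker_of_comap_eq_ker (ε : A →ₐ[k] k) (p : PrimeSpectrum (A ⊗[k] L))
    (hp : p.asIdeal.comap (algebraMap A (A ⊗[k] L)) = RingHom.ker ε) :
    p.asIdeal = RingHom.ker (Algebra.TensorProduct.lift ((Algebra.ofId k L).comp ε) (AlgHom.id k L)
      (fun _ _ ↦ .all _ _)) := by
  let εL : A ⊗[k] L →ₐ[k] L :=
    Algebra.TensorProduct.lift ((Algebra.ofId k L).comp ε) (AlgHom.id k L)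
      (fun _ _ ↦ .all _ _)
  have h1 : ∀ x, x - 1 ⊗ₜ εL x ∈ p.asIdeal := by
    intro x
    induction x with
    | zero => simp
    | add x y hx hy =>
      rw [map_add, TensorProduct.tmul_add, add_sub_add_comm]
      exact add_mem hx hy
    | tmul a l =>
      have h2 : a ⊗ₜ[k] l - 1 ⊗ₜ εL (a ⊗ₜ l) =
          algebraMap A (A ⊗[k] L) (a - algebraMap k A (ε a)) * 1 ⊗ₜ l := by
        simp only [εL, Algebra.TensorProduct.lift_tmul, AlgHom.comp_apply, AlgHom.id_apply,
          Algebra.ofId_apply, map_sub, sub_mul, Algebra.TensorProduct.algebraMap_apply,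
          Algebra.TensorProduct.tmul_mul_tmul, Algebra.algebraMap_self, RingHom.id_apply, mul_one,
          one_mul]
        rw [Algebra.algebraMap_eq_smul_one (R := k) (A := A), TensorProduct.smul_tmul,
          Algebra.smul_def]
      rw [h2]
      refine Ideal.mul_mem_right _ _ ?_
      rw [← Ideal.mem_comap, hp, RingHom.mem_ker]
      simp
  have hmax : (RingHom.ker εL).IsMaximal :=
    RingHom.ker_isMaximal_of_surjective εL fun l ↦ ⟨1 ⊗ₜ l, by simp [εL]⟩
  refine (hmax.eq_of_le p.2.ne_top fun x hx ↦ ?_).symm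
  have := h1 x
  rwa [(RingHom.mem_ker).1 hx, TensorProduct.tmul_zero, sub_zero] at this

/-- A connected affine scheme with a rational point stays connected over algebraic extensions. -/
theorem IsIdempotentElem.eq_zero_or_one_of_connected [ConnectedSpace (PrimeSpectrum A)]
    [Algebra.IsAlgebraic k L] (ε : A →ₐ[k] k) {e : A ⊗[k] L} (he : IsIdempotentElem e) :
    e = 0 ∨ e = 1 := by
  have hint : (algebraMap A (A ⊗[k] L)).IsIntegral := by
    have : Algebra.IsIntegral A (A ⊗[k] L) := inferInstance
    exact this.isIntegral
  have hεp : (RingHom.ker ε).IsPrime := RingHom.ker_isPrime _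
  -- The projection to `Spec A` is closed (integral) and open (base change of a field extension), so
  -- a nonempty clopen set maps onto `Spec A` and meets the fibre over `ε`. That fibre has one
  -- point, which cannot avoid both `e` and `1 - e`.
  have key : ∀ f : A ⊗[k] L, IsIdempotentElem f → f ≠ 0 →
      ∃ p : PrimeSpectrum (A ⊗[k] L), f ∉ p.asIdeal ∧
        p.asIdeal.comap (algebraMap A (A ⊗[k] L)) = RingHom.ker ε := by
    intro f hf hf0
    have hclopen : IsClopen (PrimeSpectrum.basicOpen f : Set (PrimeSpectrum (A ⊗[k] L))) :=
      PrimeSpectrum.isClopen_iff.2 ⟨f, hf, rfl⟩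
    have hne : (PrimeSpectrum.basicOpen f : Set (PrimeSpectrum (A ⊗[k] L))).Nonempty := by
      by_contra h
      rw [Set.not_nonempty_iff_eq_empty] at h
      have h' : PrimeSpectrum.basicOpen f = ⊥ := SetLike.coe_injective (by simpa using h)
      rw [PrimeSpectrum.basicOpen_eq_bot_iff] at h'
      exact hf0 (by
        obtain ⟨n, hn⟩ := h'
        rcases Nat.eq_zero_or_pos n with rfl | hn0
        · rw [pow_zero] at hn
          rw [← mul_one f, hn, mul_zero]
        · rwa [hf.pow_eq hn0.ne'] at hn)
    have himg : IsClopen (PrimeSpectrum.comap (algebraMap A (A ⊗[k] L)) ''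
        (PrimeSpectrum.basicOpen f : Set (PrimeSpectrum (A ⊗[k] L)))) :=
      ⟨PrimeSpectrum.isClosedMap_comap_of_isIntegral _ hint _ hclopen.1,
        PrimeSpectrum.isOpenMap_comap_algebraMap_tensorProduct_of_field _ hclopen.2⟩
    have huniv := himg.eq_univ (hne.image _)
    obtain ⟨p, hp, hp'⟩ : (⟨RingHom.ker ε, hεp⟩ : PrimeSpectrum A) ∈ _ := huniv ▸ Set.mem_univ _
    exact ⟨p, hp, congrArg PrimeSpectrum.asIdeal hp'⟩
  by_contra! h
  obtain ⟨p, hp, hp'⟩ := key e he h.1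
  obtain ⟨q, hq, hq'⟩ := key (1 - e) he.one_sub (sub_ne_zero.2 h.2.symm)
  rw [eq_ker_of_comap_eq_ker ε q hq', ← eq_ker_of_comap_eq_ker ε p hp'] at hq
  have h0 : e * (1 - e) ∈ p.asIdeal := by
    rw [he.mul_one_sub_self]
    exact zero_mem _
  exact (p.2.mem_or_mem h0).elim hp hq

end Connected

/-! ### Rational points and integrality over an algebraically closed field. -/

section Points

variable {K A : Type*} [Field K] [IsAlgClosed K] [CommRing A] [Algebra K A] [Algebra.FiniteType K A]

theorem exists_ker_eq_of_isMaximal (m : Ideal A) [m.IsMaximal] :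
    ∃ x : A →ₐ[K] K, RingHom.ker x = m := by
  let : Field (A ⧸ m) := Ideal.Quotient.field m
  have : Algebra.FiniteType K (A ⧸ m) := inferInstance
  have hfin : Module.Finite K (A ⧸ m) := finite_of_finite_type_of_isJacobsonRing K (A ⧸ m)
  have hbij := IsAlgClosed.algebraMap_bijective_of_isIntegral (k := K) (K := A ⧸ m)
  let e : K ≃ₐ[K] A ⧸ m := AlgEquiv.ofBijective (Algebra.ofId K (A ⧸ m)) hbij
  refine ⟨(e.symm : (A ⧸ m) →ₐ[K] K).comp (Ideal.Quotient.mkₐ K m), ?_⟩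
  ext a
  rw [RingHom.mem_ker, AlgHom.comp_apply, AlgEquiv.coe_toAlgHom,
    EmbeddingLike.map_eq_zero_iff, Ideal.Quotient.mkₐ_eq_mk, Ideal.Quotient.eq_zero_iff_mem]

theorem exists_algHom_ne_zero [IsReduced A] {a : A} (ha : a ≠ 0) : ∃ x : A →ₐ[K] K, x a ≠ 0 := by
  have : IsJacobsonRing A := isJacobsonRing_of_finiteType (A := K)
  have h1 : (⊥ : Ideal A).jacobson = ⊥ :=
    IsJacobsonRing.out inferInstance (by
      rw [Ideal.isRadical_iff_quotient_reduced]
      exact isReduced_of_injective (RingEquiv.quotientBot A) (RingEquiv.quotientBot A).injective)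
  have h2 : a ∉ (⊥ : Ideal A).jacobson := by rwa [h1, Ideal.mem_bot]
  rw [Ideal.jacobson, Ideal.mem_sInf] at h2
  push Not at h2
  obtain ⟨m, ⟨-, hm⟩, ham⟩ := h2
  obtain ⟨x, hx⟩ := exists_ker_eq_of_isMaximal (K := K) m
  exact ⟨x, fun h ↦ ham (hx ▸ h)⟩

/-- Over an algebraically closed field, tensor products of domains are domains. -/
theorem isDomain_tensorProduct_of_isAlgClosed [IsDomain A] (D : Type*) [CommRing D] [IsDomain D]
    [Algebra K D] : IsDomain (D ⊗[K] A) := by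
  classical
  have : Nontrivial (D ⊗[K] A) := by
    obtain ⟨x, -⟩ := exists_algHom_ne_zero (K := K) (one_ne_zero (α := A))
    let f : D ⊗[K] A →ₐ[K] D :=
      Algebra.TensorProduct.lift (AlgHom.id K D) ((Algebra.ofId K D).comp x) (fun _ _ ↦ .all _ _)
    exact f.toRingHom.domain_nontrivial
  let b := Module.Basis.ofVectorSpace K D
  -- Take for `a` a nonzero coordinate of `u` in a `K`-basis of `D`; a point where `a` does not
  -- vanish specializes `u` to a nonzero element of `D`.
  have hne : ∀ u : D ⊗[K] A, u ≠ 0 → ∃ a : A, a ≠ 0 ∧ ∀ x : A →ₐ[K] K, x a ≠ 0 →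
      Algebra.TensorProduct.lift (AlgHom.id K D) ((Algebra.ofId K D).comp x)
        (fun _ _ ↦ .all _ _) u ≠ 0 := by
    intro u hu
    let e := TensorProduct.equivFinsuppOfBasisLeft (N := A) b
    have h1 : ∀ (x : A →ₐ[K] K) (w : D ⊗[K] A) i,
        b.repr (Algebra.TensorProduct.lift (AlgHom.id K D) ((Algebra.ofId K D).comp x)
          (fun _ _ ↦ .all _ _) w) i = x (e w i) := by
      intro x w i
      induction w with
      | zero => simp
      | add w w' h h' => simp only [map_add, Finsupp.add_apply, h, h']
      | tmul d a =>
        simp only [Algebra.TensorProduct.lift_tmul, AlgHom.id_apply, AlgHom.comp_apply,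
          Algebra.ofId_apply, e, TensorProduct.equivFinsuppOfBasisLeft_apply_tmul_apply]
        rw [mul_comm, ← Algebra.smul_def, map_smul, map_smul]
        simp [mul_comm]
    have h2 : e u ≠ 0 := by simpa using hu
    obtain ⟨i, hi⟩ := Finsupp.ne_iff.1 h2
    refine ⟨e u i, hi, fun x hx h0 ↦ hx ?_⟩
    rw [← h1 x u i, h0]
    simp
  have : NoZeroDivisors (D ⊗[K] A) := by
    refine ⟨fun {u v} huv ↦ ?_⟩
    by_contra! h
    obtain ⟨a, ha, hau⟩ := hne u h.1
    obtain ⟨a', ha', hav⟩ := hne v h.2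
    obtain ⟨x, hx⟩ := exists_algHom_ne_zero (K := K) (mul_ne_zero ha ha')
    rw [map_mul] at hx
    refine mul_ne_zero (hau x (left_ne_zero_of_mul hx)) (hav x (right_ne_zero_of_mul hx)) ?_
    rw [← map_mul, huv, map_zero]
  exact NoZeroDivisors.to_isDomain _

end Points

/-! ### Translations and irreducible components. -/

section Translation

open WithConv

variable {K A : Type*} [Field K] [CommRing A] [HopfAlgebra K A]

/-- Translation by a rational point. -/
noncomputable def pointTranslation (g : WithConv (A →ₐ[K] K)) : A →ₐ[K] A :=
  (toConv ((Algebra.ofId K A).comp g.ofConv) * toConv (AlgHom.id K A)).ofConv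

theorem comp_pointTranslation (g x : WithConv (A →ₐ[K] K)) :
    x.ofConv.comp (pointTranslation g) = (g * x).ofConv := by
  have h1 : x.ofConv.comp ((Algebra.ofId K A).comp g.ofConv) = g.ofConv := by
    ext a
    simp [Algebra.ofId_apply]
  rw [pointTranslation, AlgHom.comp_convMul_distrib]
  simp only [AlgHom.comp_id]
  rw [h1]

theorem pointTranslation_comp_of_mul_eq_one {g h : WithConv (A →ₐ[K] K)} (hgh : h * g = 1) :
    (pointTranslation g).comp (pointTranslation h) = AlgHom.id K A := by
  have h1 : (pointTranslation g).comp ((Algebra.ofId K A).comp h.ofConv) =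
      (Algebra.ofId K A).comp h.ofConv := by
    ext a
    simp [Algebra.ofId_apply]
  have h2 : toConv ((Algebra.ofId K A).comp h.ofConv) * toConv ((Algebra.ofId K A).comp g.ofConv) =
      1 := by
    have h3 := AlgHom.comp_convMul_distrib (Algebra.ofId K A) h g
    rw [hgh] at h3
    apply WithConv.ofConv_injective
    rw [← h3]
    ext a
    simp [AlgHom.convOne_def, Algebra.ofId_apply]
  conv_lhs => rw [pointTranslation.eq_def h]
  rw [AlgHom.comp_convMul_distrib]
  simp only [AlgHom.comp_id]
  rw [h1, pointTranslation, toConv_ofConv, ← mul_assoc, h2, one_mul]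

/-- Translation by a rational point, as an automorphism. -/
noncomputable def pointTranslationEquiv (g : WithConv (A →ₐ[K] K)) : A ≃ₐ[K] A :=
  AlgEquiv.ofAlgHom (pointTranslation g) (pointTranslation g⁻¹)
    (pointTranslation_comp_of_mul_eq_one (inv_mul_cancel g))
    (pointTranslation_comp_of_mul_eq_one (mul_inv_cancel g))

theorem exists_algEquiv_comp_eq (x y : A →ₐ[K] K) : ∃ τ : A ≃ₐ[K] A, x.comp τ = y := by
  refine ⟨pointTranslationEquiv (toConv y * (toConv x)⁻¹), ?_⟩
  have := comp_pointTranslation (toConv y * (toConv x)⁻¹) (toConv x)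
  rw [inv_mul_cancel_right] at this
  exact this

theorem comap_mem_minimalPrimes (τ : A ≃ₐ[K] A) {p : Ideal A} (hp : p ∈ minimalPrimes A) :
    p.comap τ ∈ minimalPrimes A := by
  have hp' : p.IsPrime := hp.1.1
  refine ⟨⟨Ideal.comap_isPrime τ p, bot_le⟩, fun q hq hqp ↦ ?_⟩
  have hq' : q.IsPrime := hq.1
  have h1 : p ≤ q.comap (τ.symm : A →ₐ[K] A) := by
    refine hp.2 ⟨Ideal.comap_isPrime _ q, bot_le⟩ fun a ha ↦ ?_
    have := hqp (Ideal.mem_comap.1 ha)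
    simpa [Ideal.mem_comap] using this
  intro a ha
  have := h1 (Ideal.mem_comap.1 ha)
  simpa [Ideal.mem_comap] using this

/-- A reduced connected affine algebraic group over an algebraically closed field is integral. -/
theorem isDomain_of_isReduced_of_connected [IsAlgClosed K] [Algebra.FiniteType K A] [IsReduced A]
    (hconn : ∀ e : A, IsIdempotentElem e → e = 0 ∨ e = 1) : IsDomain A := by
  have : Nontrivial A := (Bialgebra.counitAlgHom K A).toRingHom.domain_nontrivial
  have : IsNoetherianRing A := Algebra.FiniteType.isNoetherianRing K A
  have : IsJacobsonRing A := isJacobsonRing_of_finiteType (A := K)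
  have hfin : (minimalPrimes A).Finite := minimalPrimes.finite_of_isNoetherianRing A
  have hbot : sInf (minimalPrimes A) = ⊥ := by
    have := nilradical_eq_zero A
    rwa [nilradical, ← Ideal.sInf_minimalPrimes] at this
  obtain ⟨p, hp⟩ : (minimalPrimes A).Nonempty := Set.nonempty_coe_sort.1
    (Ideal.nonempty_minimalPrimes bot_ne_top)
  have hpp : p.IsPrime := hp.1.1
  let T := hfin.toFinset.erase p
  let J : Ideal A := T.inf id
  have hT : ∀ q, q ∈ T ↔ q ≠ p ∧ q ∈ minimalPrimes A := by simp [T]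
  have hpJ : p ⊓ J = ⊥ := by
    rw [← hbot, eq_comm]
    apply le_antisymm
    · exact le_inf (sInf_le hp) (Finset.le_inf fun q hq ↦ sInf_le ((hT q).1 hq).2)
    · refine le_sInf fun q hq ↦ ?_
      by_cases hqp : q = p
      · exact hqp ▸ inf_le_left
      · exact inf_le_right.trans (Finset.inf_le ((hT q).2 ⟨hqp, hq⟩))
  have hJm : ∀ m : Ideal A, m.IsPrime → J ≤ m → ∃ q ∈ minimalPrimes A, q ≠ p ∧ q ≤ m := by
    intro m hm h
    obtain ⟨q, hq, hqm⟩ := (hm.inf_le').1 h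
    exact ⟨q, ((hT q).1 hq).2, ((hT q).1 hq).1, hqm⟩
  have hJp : ¬ J ≤ p := by
    intro h
    obtain ⟨q, hq, hqp, hqp'⟩ := hJm p hpp h
    exact hqp (le_antisymm hqp' (hp.2 hq.1 hqp'))
  -- By the Nullstellensatz some point of the component of `p` lies on no other component.
  have hx : ∃ x : A →ₐ[K] K, ∀ q ∈ minimalPrimes A, ∀ q' ∈ minimalPrimes A,
      q ≤ RingHom.ker x → q' ≤ RingHom.ker x → q = q' := by
    obtain ⟨a, haJ, hap⟩ := SetLike.not_le_iff_exists.1 hJp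
    have h1 : p.jacobson = p := IsJacobsonRing.out inferInstance hpp.isRadical
    have h2 : a ∉ p.jacobson := by rwa [h1]
    rw [Ideal.jacobson, Ideal.mem_sInf] at h2
    push Not at h2
    obtain ⟨m, ⟨hpm, hm⟩, ham⟩ := h2
    obtain ⟨x, hx⟩ := exists_ker_eq_of_isMaximal (K := K) m
    have h3 : ∀ q ∈ minimalPrimes A, q ≤ RingHom.ker x → q = p := by
      intro q hq hqx
      by_contra hne
      exact ham (hx ▸ hqx (Finset.inf_le (f := id) ((hT q).2 ⟨hne, hq⟩) haJ))
    exact ⟨x, fun q hq q' hq' h h' ↦ (h3 q hq h).trans (h3 q' hq' h').symm⟩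
  obtain ⟨x, hx⟩ := hx
  -- Translations are transitive on points and permute the components, so every point lies on only
  -- one.
  have hy : ∀ y : A →ₐ[K] K, ∀ q ∈ minimalPrimes A, ∀ q' ∈ minimalPrimes A,
      q ≤ RingHom.ker y → q' ≤ RingHom.ker y → q = q' := by
    intro y q hq q' hq' h h'
    obtain ⟨τ, hτ⟩ := exists_algEquiv_comp_eq y x
    have h1 : ∀ q, q ≤ RingHom.ker y → q.comap τ ≤ RingHom.ker x := by
      intro q hqy a ha
      rw [RingHom.mem_ker, ← hτ]
      exact hqy ha
    have h2 := hx _ (comap_mem_minimalPrimes τ hq) _ (comap_mem_minimalPrimes τ hq')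
      (h1 q h) (h1 q' h')
    exact Ideal.comap_injective_of_surjective τ τ.surjective h2
  -- The component of `p` is thus disjoint from the others, which yields an idempotent.
  have htop : p ⊔ J = ⊤ := by
    by_contra h
    obtain ⟨m, hm, hpJm⟩ := Ideal.exists_le_maximal _ h
    obtain ⟨y, rfl⟩ := exists_ker_eq_of_isMaximal (K := K) m
    obtain ⟨q, hq, hqp, hqm⟩ := hJm _ hm.isPrime (le_sup_right.trans hpJm)
    exact hqp (hy y q hq p hp hqm (le_sup_left.trans hpJm))
  obtain ⟨a, ha, b, hb, hab⟩ := Submodule.mem_sup.1 (htop ▸ Submodule.mem_top : (1 : A) ∈ p ⊔ J)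
  have hab0 : a * b = 0 := by
    rw [← Ideal.mem_bot, ← hpJ]
    exact ⟨p.mul_mem_right _ ha, J.mul_mem_left _ hb⟩
  have hid : IsIdempotentElem a := by
    have : b = 1 - a := by rw [← hab]; ring
    rw [this, mul_sub, mul_one, sub_eq_zero] at hab0
    exact hab0.symm
  rcases hconn a hid with rfl | rfl
  · have hJ : J = ⊤ := by
      rw [Ideal.eq_top_iff_one, ← hab, zero_add]
      exact hb
    rw [hJ, inf_top_eq] at hpJ
    subst hpJ
    exact IsDomain.of_bot_isPrime A
  · exact (hpp.ne_top ((Ideal.eq_top_iff_one p).2 ha)).elim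

end Translation

/-! ### Geometric integrality. -/

section GeometricallyIntegral

variable (k : Type*) [Field k] (H : Type*) [CommRing H] [HopfAlgebra k H]
  [Algebra.Smooth k H] [ConnectedSpace (PrimeSpectrum H)]

theorem isDomain_algebraicClosure_tensorProduct : IsDomain (AlgebraicClosure k ⊗[k] H) := by
  have : IsReduced (AlgebraicClosure k ⊗[k] H) :=
    isReduced_of_smooth (AlgebraicClosure k) _
  refine isDomain_of_isReduced_of_connected (K := AlgebraicClosure k) fun e he ↦ ?_
  let σ := Algebra.TensorProduct.comm k (AlgebraicClosure k) H
  have h1 : IsIdempotentElem (σ e) := he.map σ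
  exact (IsIdempotentElem.eq_zero_or_one_of_connected (Bialgebra.counitAlgHom k H) h1).imp
    (fun h ↦ by simpa using h) (fun h ↦ by simpa using h)

/-- A connected smooth affine algebraic group over a field is geometrically integral. -/
theorem isDomain_tensorProduct_of_smooth_of_connected (D : Type*) [CommRing D] [IsDomain D]
    [Algebra k D] : IsDomain (D ⊗[k] H) := by
  have h1 := isDomain_algebraicClosure_tensorProduct k H
  -- `D` embeds in an algebraically closed field `L` containing the algebraic closure of `k`, over
  -- which the previous results apply.
  let L := AlgebraicClosure (FractionRing D)
  let f : AlgebraicClosure k →ₐ[k] L := IsAlgClosed.lift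
  let : Algebra (AlgebraicClosure k) L := f.toRingHom.toAlgebra
  have : IsScalarTower k (AlgebraicClosure k) L := IsScalarTower.of_algebraMap_eq'
    f.comp_algebraMap.symm
  have h2 : IsDomain (L ⊗[AlgebraicClosure k] (AlgebraicClosure k ⊗[k] H)) :=
    isDomain_tensorProduct_of_isAlgClosed L
  let σ := Algebra.TensorProduct.cancelBaseChange k (AlgebraicClosure k) L L H
  have h3 : IsDomain (L ⊗[k] H) := σ.symm.toMulEquiv.isDomain
  let g : D →ₐ[k] L := IsScalarTower.toAlgHom k D L
  have hg : Function.Injective g := by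
    have : Function.Injective (algebraMap D L) := by
      rw [IsScalarTower.algebraMap_eq D (FractionRing D) L]
      exact (algebraMap (FractionRing D) L).injective.comp (IsFractionRing.injective D _)
    exact this
  have h4 : Function.Injective (Algebra.TensorProduct.map g (AlgHom.id k H)) :=
    Module.Flat.rTensor_preserves_injective_linearMap (M := H) g.toLinearMap hg
  exact h4.isDomain (Algebra.TensorProduct.map g (AlgHom.id k H)).toRingHom

end GeometricallyIntegral

/-! ### Characters form a free abelian group of finite rank. -/

section FieldEqualizer

/-- Otherwise an `E`-linear form killing `1` but not `x`, applied to the first factor, separates the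
two tensors. -/
theorem mem_range_algebraMap_of_tmul_one_eq {E L : Type*} [Field E] [CommRing L] [Nontrivial L]
    [Algebra E L] {x : L} (hx : x ⊗ₜ[E] (1 : L) = 1 ⊗ₜ x) : x ∈ Set.range (algebraMap E L) := by
  by_contra h
  have h1 : x ∉ Submodule.span E {(1 : L)} := by
    intro h2
    obtain ⟨r, hr⟩ := Submodule.mem_span_singleton.1 h2
    exact h ⟨r, by rw [← hr, Algebra.smul_def, mul_one]⟩
  obtain ⟨f, hfx, hf⟩ := Submodule.exists_le_ker_of_notMem h1
  have hf1 : f 1 = 0 := hf (Submodule.mem_span_singleton_self _)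
  have h2 := congrArg (fun t ↦ TensorProduct.lid E L (f.rTensor L t)) hx
  simp only [LinearMap.rTensor_tmul, TensorProduct.lid_tmul, hf1, zero_smul] at h2
  rcases smul_eq_zero.1 h2 with h3 | h3
  · exact hfx h3
  · exact one_ne_zero h3

end FieldEqualizer

section CharacterGroup

variable {k H : Type*} [Field k] [CommRing H] [HopfAlgebra k H] [IsDomain H]

/-- For `χ` of finite order, `(χ - 1)(1 + χ + ⋯) = 0` over one period; the second factor is nonzero
by linear independence of characters. -/
theorem GroupLike.isMulTorsionFree : IsMulTorsionFree (GroupLike k H) := by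
  refine isMulTorsionFree_iff_not_isOfFinOrder.2 fun χ hχ hfin ↦ hχ ?_
  have h1 : ((χ : H) - 1) * ∑ i ∈ Finset.range (orderOf χ), (χ : H) ^ i = 0 := by
    rw [mul_geom_sum, ← GroupLike.val_pow, pow_orderOf_eq_one, GroupLike.val_one, sub_self]
  rcases mul_eq_zero.1 h1 with h2 | h2
  · exact GroupLike.val_injective (sub_eq_zero.1 h2)
  · exfalso
    have hinj : Function.Injective fun i : Fin (orderOf χ) ↦ χ ^ (i : ℕ) := fun i j hij ↦
      Fin.ext (pow_injOn_Iio_orderOf i.2 j.2 hij)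
    have h3 := (linearIndep_groupLikeVal (R := k) (A := H)).comp _ hinj
    rw [Finset.sum_range] at h2
    have h4 := Fintype.linearIndependent_iff.1 h3 (fun _ ↦ 1) (by simpa using h2)
      ⟨0, hfin.orderOf_pos⟩
    exact one_ne_zero h4

/-- By independence of characters, the characters occurring in `χ b` are the `χ`-translates of those
occurring in `b`. -/
theorem mem_of_val_mul_mem_span {χ : GroupLike k H} {Γ : Subgroup (GroupLike k H)} {b : H}
    (hb : b ∈ Submodule.span k (GroupLike.val '' (Γ : Set (GroupLike k H)))) (hb0 : b ≠ 0)
    (hχb : χ * b ∈ Submodule.span k (GroupLike.val '' (Γ : Set (GroupLike k H)))) : χ ∈ Γ := by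
  rw [Finsupp.mem_span_image_iff_linearCombination] at hb hχb
  obtain ⟨l, hl, rfl⟩ := hb
  obtain ⟨l', hl', h⟩ := hχb
  have h1 : Finsupp.linearCombination k GroupLike.val l' =
      Finsupp.linearCombination k GroupLike.val (l.mapDomain (χ * ·)) := by
    rw [h, Finsupp.linearCombination_mapDomain, Finsupp.linearCombination_apply,
      Finsupp.linearCombination_apply, Finsupp.mul_sum]
    simp
  have h2 := (linearIndep_groupLikeVal (R := k) (A := H)) h1
  have hl0 : l ≠ 0 := by
    rintro rfl
    exact hb0 (map_zero _)
  obtain ⟨δ, hδ⟩ := Finsupp.ne_iff.1 hl0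
  have h3 : χ * δ ∈ l'.support := by
    rw [Finsupp.mem_support_iff, h2, Finsupp.mapDomain_apply (mul_right_injective χ)]
    exact hδ
  exact (Γ.mul_mem_cancel_right (hl (Finsupp.mem_support_iff.2 hδ))).1 (hl' h3)

/-- A character trivial on the common kernel of `Γ` belongs to `Γ`. Let `E = k(Γ)` inside `L = Frac
H`. The map `θ`, pullback along `(g, h) ↦ g⁻¹h`, sends each `γ ∈ Γ` to `γ⁻¹ ⊗ γ = 1` in `L ⊗[E] L`,
hence also `χ` to `1`. So `χ ⊗ 1 = 1 ⊗ χ`, which puts `χ` in `E`, a quotient of combinations of `Γ`.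
-/
theorem mem_of_val_sub_one_mem_span {χ : GroupLike k H} {Γ : Subgroup (GroupLike k H)}
    (h : (χ : H) - 1 ∈ Ideal.span ((fun γ : GroupLike k H ↦ (γ : H) - 1) '' Γ)) : χ ∈ Γ := by
  let L := FractionRing H
  let ι : H →ₐ[k] L := IsScalarTower.toAlgHom k H L
  have hι : Function.Injective ι := IsFractionRing.injective H L
  let V : Set H := GroupLike.val '' (Γ : Set (GroupLike k H))
  let E := IntermediateField.adjoin k (ι '' V)
  let θ : H →ₐ[k] L ⊗[E] L := (Algebra.TensorProduct.lift
    (((Algebra.TensorProduct.includeLeft : L →ₐ[E] L ⊗[E] L).restrictScalars k).comp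
      (ι.comp (HopfAlgebra.antipodeAlgHom k H)))
    (((Algebra.TensorProduct.includeRight : L →ₐ[E] L ⊗[E] L).restrictScalars k).comp ι)
    fun _ _ ↦ Commute.all _ _).comp (Bialgebra.comulAlgHom k H)
  have hθ : ∀ γ : GroupLike k H, θ γ = ι (HopfAlgebra.antipode k (γ : H)) ⊗ₜ ι γ := by
    intro γ
    simp [θ]
  have hΓ : Ideal.span ((fun γ : GroupLike k H ↦ (γ : H) - 1) '' Γ) ≤ RingHom.ker θ := by
    rw [Ideal.span_le]
    rintro - ⟨γ, hγ, rfl⟩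
    have h1 : ι γ ∈ E := IntermediateField.subset_adjoin k _ ⟨γ, ⟨γ, hγ, rfl⟩, rfl⟩
    have h2 : ι γ = (⟨ι γ, h1⟩ : E) • (1 : L) := by
      rw [Algebra.smul_def, mul_one]
      rfl
    have h3 : (⟨ι γ, h1⟩ : E) • ι (HopfAlgebra.antipode k (γ : H)) = 1 := by
      rw [Algebra.smul_def]
      change ι γ * _ = 1
      rw [← map_mul, γ.2.mul_antipode_cancel, map_one]
    rw [SetLike.mem_coe, RingHom.mem_ker, map_sub, map_one, hθ, h2, ← TensorProduct.smul_tmul, h3,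
      sub_eq_zero]
    rfl
  have h1 : θ χ = 1 := by
    have := hΓ h
    rwa [RingHom.mem_ker, map_sub, map_one, sub_eq_zero] at this
  have h2 : ι χ ⊗ₜ[E] (1 : L) = 1 ⊗ₜ ι χ := by
    rw [hθ] at h1
    have h3 := congrArg (fun t ↦ (ι χ ⊗ₜ[E] (1 : L)) * t) h1
    simp only [Algebra.TensorProduct.tmul_mul_tmul, mul_one, one_mul] at h3
    rw [← h3, ← map_mul, χ.2.mul_antipode_cancel, map_one]
  obtain ⟨⟨y, hy⟩, hyχ⟩ := mem_range_algebraMap_of_tmul_one_eq h2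
  change y = ι χ at hyχ
  subst hyχ
  obtain ⟨r, hr, s, hs, hrs⟩ := (IntermediateField.mem_adjoin_iff_div).1 hy
  rw [← AlgHom.map_adjoin] at hr hs
  obtain ⟨a, ha, rfl⟩ := hr
  obtain ⟨b, hb, rfl⟩ := hs
  have hV : ∀ a ∈ Algebra.adjoin k V, a ∈ Submodule.span k V := by
    intro a ha
    have h4 : V = (Γ.toSubmonoid.map (GroupLike.valMonoidHom k H) : Set H) := rfl
    rw [← Subalgebra.mem_toSubmodule, Algebra.adjoin_eq_span, h4, Submonoid.closure_eq] at ha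
    exact ha
  have hb0 : b ≠ 0 := by
    rintro rfl
    rw [map_zero, div_zero] at hrs
    exact χ.2.ne_zero (hι (hrs.trans (map_zero ι).symm))
  refine mem_of_val_mul_mem_span (hV b hb) hb0 ?_
  have h5 : (χ : H) * b = a := by
    apply hι
    rw [map_mul, hrs]
    exact div_mul_cancel₀ _ fun h ↦ hb0 (hι (h.trans (map_zero ι).symm))
  rw [h5]
  exact hV a ha

/-- The ideal of all `χ - 1` is generated by finitely many of them, and the corresponding characters
generate the group. -/
theorem GroupLike.fg [IsNoetherianRing H] : Group.FG (GroupLike k H) := by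
  classical
  let f := fun γ : GroupLike k H ↦ (γ : H) - 1
  obtain ⟨s, hs, hspan⟩ := (Submodule.fg_span_iff_fg_span_finset_subset (f '' Set.univ)).1
    (IsNoetherian.noetherian (Ideal.span (f '' Set.univ)))
  obtain ⟨t, -, rfl⟩ := Finset.subset_set_image_iff.1 hs
  refine ⟨⟨t, eq_top_iff.2 fun χ _ ↦ mem_of_val_sub_one_mem_span ?_⟩⟩
  have h1 : f χ ∈ Ideal.span (f '' Set.univ) := Ideal.subset_span ⟨χ, trivial, rfl⟩
  rw [Ideal.span, hspan, Finset.coe_image] at h1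
  exact Ideal.span_mono (Set.image_mono Subgroup.subset_closure) h1

/-- The group of characters of an integral algebraic group is free of finite rank. -/
theorem exists_groupLike_indexing (k H : Type*) [Field k] [CommRing H] [HopfAlgebra k H]
    [IsDomain H] [IsNoetherianRing H] : ∃ (n : ℕ) (c : Lex (Fin n → ℤ) → H),
    LinearIndependent k c ∧ Set.range c = {χ | IsGroupLikeElem k χ} ∧ c 0 = 1 ∧
      ∀ i j, c (i + j) = c i * c j := by
  have := GroupLike.isMulTorsionFree (k := k) (H := H)
  have := GroupLike.fg (k := k) (H := H)
  have : Module.Finite ℤ (Additive (GroupLike k H)) :=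
    Module.Finite.iff_addGroup_fg.2 inferInstance
  obtain ⟨n, b⟩ := Module.basisOfFiniteTypeTorsionFree' (R := ℤ) (M := Additive (GroupLike k H))
  let e : (Fin n → ℤ) ≃ₗ[ℤ] Additive (GroupLike k H) := b.equivFun.symm
  refine ⟨n, fun i ↦ (e (ofLex i)).toMul.val, ?_, ?_, ?_, ?_⟩
  · exact (linearIndep_groupLikeVal (R := k) (A := H)).comp _
      (Additive.toMul.injective.comp (e.injective.comp ofLex.injective))
  · ext χ
    constructor
    · rintro ⟨i, rfl⟩
      exact (e (ofLex i)).toMul.2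
    · intro hχ
      refine ⟨toLex (e.symm (Additive.ofMul ⟨χ, hχ⟩)), ?_⟩
      simp
  · simp
  · intro i j
    simp

end CharacterGroup

namespace GroupSchemeAction

/-! ### Semiinvariants over a field and the proof of (2). -/

section SumTmulField

variable {k : Type*} [Field k] {H : Type*} [CommRing H] [HopfAlgebra k H] {ι : Type*} {c : ι → H}

theorem sumTmul_injective_of_linearIndependent (hc : LinearIndependent k c)
    (M : Type*) [AddCommGroup M] [Module k M] :
    Function.Injective (sumTmul (R := k) c M) := by
  classical
  have h1 := sumTmul_injective_of_basis (Module.Basis.span hc) (Submodule.subtype _) M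
    (Module.Flat.lTensor_preserves_injective_linearMap _ (Submodule.injective_subtype _))
  simpa only [Submodule.subtype_apply, Module.Basis.span_apply] using h1

theorem range_sumTmul_eq_ker (hc : LinearIndependent k c)
    (M : Type*) [AddCommGroup M] [Module k M] :
    LinearMap.range (sumTmul (R := k) c M) =
      LinearMap.ker ((Submodule.span k (Set.range c)).mkQ.lTensor M) := by
  classical
  have h1 := range_sumTmul_of_basis (Module.Basis.span hc) (Submodule.subtype _) M
  simp only [Submodule.subtype_apply, Module.Basis.span_apply] at h1
  rw [h1]
  have h2 : Function.Exact (Submodule.span k (Set.range c)).subtype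
      (Submodule.span k (Set.range c)).mkQ := LinearMap.exact_subtype_mkQ _
  exact ((lTensor_exact M h2 (Submodule.mkQ_surjective _)).linearMap_ker_eq).symm

/-- The cokernel is `S ⊗ (H ⧸ span c)`, torsion-free over the domain `S` because `k` is a field. -/
theorem mem_range_sumTmul_of_tmul_one_mul_mem (hc : LinearIndependent k c) {S : Type*} [CommRing S]
    [IsDomain S] [Algebra k S] {f : S} (hf : f ≠ 0) {t : S ⊗[k] H}
    (h : f ⊗ₜ 1 * t ∈ LinearMap.range (sumTmul (R := k) c S)) :
    t ∈ LinearMap.range (sumTmul (R := k) c S) := by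
  rw [range_sumTmul_eq_ker hc, LinearMap.mem_ker] at h ⊢
  have h1 : ∀ t : S ⊗[k] H, (Submodule.span k (Set.range c)).mkQ.lTensor S (f ⊗ₜ 1 * t) =
      f • (Submodule.span k (Set.range c)).mkQ.lTensor S t := by
    intro t
    induction t with
    | zero => simp
    | add x y hx hy => simp only [mul_add, map_add, smul_add, hx, hy]
    | tmul s a => simp [TensorProduct.smul_tmul']
  rw [h1] at h
  exact (smul_eq_zero.1 h).resolve_left hf

end SumTmulField

section SumTmulMul

variable {R : Type*} [CommRing R] {H : Type*} [CommRing H] [HopfAlgebra R H]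
  {S : Type*} [CommRing S] [Algebra R S] {ι : Type*} {c : ι → H}

theorem mul_mem_range_sumTmul [Add ι] (hcadd : ∀ i j, c (i + j) = c i * c j) {x y : S ⊗[R] H}
    (hx : x ∈ LinearMap.range (sumTmul (R := R) c S))
    (hy : y ∈ LinearMap.range (sumTmul (R := R) c S)) :
    x * y ∈ LinearMap.range (sumTmul (R := R) c S) := by
  obtain ⟨x, rfl⟩ := hx
  obtain ⟨y, rfl⟩ := hy
  induction x using Finsupp.induction_linear with
  | zero => simp
  | add x x' hx hx' =>
    rw [map_add, add_mul]
    exact add_mem hx hx'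
  | single i s =>
    induction y using Finsupp.induction_linear with
    | zero => simp
    | add y y' hy hy' =>
      rw [map_add, mul_add]
      exact add_mem hy hy'
    | single j t =>
      refine ⟨Finsupp.single (i + j) (s * t), ?_⟩
      rw [sumTmul_single, sumTmul_single, sumTmul_single, Algebra.TensorProduct.tmul_mul_tmul,
        hcadd]

variable (act : GroupSchemeAction R H S)

theorem coaction_mem_range_sumTmul [AddZeroClass ι] (hc0 : c 0 = 1)
    (hcadd : ∀ i j, c (i + j) = c i * c j) (hrange : Set.range c = {χ | IsGroupLikeElem R χ})
    {s : S} (hs : s ∈ act.semiinvariants) :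
    act.coaction s ∈ LinearMap.range (sumTmul (R := R) c S) := by
  induction hs using Algebra.adjoin_induction with
  | mem f hf =>
    obtain ⟨χ, hχ, hf⟩ := hf
    obtain ⟨i, rfl⟩ : χ ∈ Set.range c := hrange ▸ hχ
    exact ⟨Finsupp.single i f, by rw [hf, sumTmul_single]⟩
  | algebraMap r =>
    refine ⟨Finsupp.single 0 (algebraMap R S r), ?_⟩
    rw [sumTmul_single, hc0, AlgHom.commutes, Algebra.TensorProduct.algebraMap_apply]
  | add x y _ _ hx hy =>
    rw [map_add]
    exact add_mem hx hy
  | mul x y _ _ hx hy =>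
    rw [map_mul]
    exact mul_mem_range_sumTmul hcadd hx hy

end SumTmulMul

section Semiinvariants

variable {k : Type u} [Field k] {H : Type u} [CommRing H] [HopfAlgebra k H]
  [Algebra.Smooth k H] [ConnectedSpace (PrimeSpectrum H)]

/-- The core is the kernel of a map to `(S ⧸ P) ⊗ H`, a domain by geometric integrality. -/
theorem isPrime_core {S : Type*} [CommRing S] [Algebra k S] (act : GroupSchemeAction k H S)
    (P : Ideal S) [P.IsPrime] : (act.core P).IsPrime := by
  have := isDomain_tensorProduct_of_smooth_of_connected k H (S ⧸ P)
  have h1 : act.core P = RingHom.ker ((Algebra.TensorProduct.map (Ideal.Quotient.mkₐ k P)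
      (AlgHom.id k H)).comp act.coaction) := by
    ext s
    exact mem_map_includeLeft_iff
  rw [h1]
  exact RingHom.ker_isPrime _

theorem isDomain_and_uniqueFactorizationMonoid_semiinvariants {S : Type v} [CommRing S]
    [Algebra k S] [IsNoetherianRing S] [IsDomain S] (act : GroupSchemeAction k H S)
    (hprin : ∀ P : Ideal S, P.IsPrime → act.IsStable P → P.height = 1 →
      PrincipalContractionIfMinimal act.semiinvariants P) :
    IsDomain act.semiinvariants ∧ UniqueFactorizationMonoid act.semiinvariants := by
  have : IsDomain (k ⊗[k] H) := isDomain_tensorProduct_of_smooth_of_connected k H k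
  have : IsDomain H := (Algebra.TensorProduct.lid k H).symm.toMulEquiv.isDomain
  have : IsNoetherianRing H := Algebra.FiniteType.isNoetherianRing k H
  obtain ⟨n, c, hli, hrange, hc0, hcadd⟩ := exists_groupLike_indexing k H
  have hc : ∀ i, IsGroupLikeElem k (c i) := fun i ↦
    (hrange ▸ Set.mem_range_self i : c i ∈ {χ | IsGroupLikeElem k χ})
  have hA : ∀ i, ∀ s ∈ act.weightSpace (c i), s ∈ act.semiinvariants := fun i s hs ↦
    Algebra.subset_adjoin ⟨c i, hc i, hs⟩
  have hA' : ∀ s ∈ act.semiinvariants, act.coaction s ∈ LinearMap.range (sumTmul (R := k) c S) :=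
    fun s hs ↦ act.coaction_mem_range_sumTmul hc0 hcadd hrange hs
  have hinj := sumTmul_injective_of_linearIndependent hli (S ⊗[k] H)
  obtain ⟨_⟩ := act.nonempty_gradedRing_gradedPiece hc hc0 hcadd
    (sumTmul_injective_of_linearIndependent hli S) hinj
    act.semiinvariants hA hA'
  refine isDomain_and_uniqueFactorizationMonoid_of_principalContraction act.semiinvariants
    (act.gradedPiece act.semiinvariants c) ?_ ?_ ?_
  · intro i f hf hf0
    exact mem_nonZeroDivisors_of_ne_zero fun h ↦ hf0 (Subtype.ext h)
  · intro i f hf hf0 s hs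
    have hf' : act.coaction (f : S) = (f : S) ⊗ₜ c i := hf
    -- Twisting by the inverse character `c (-i)` turns `ω(f) = f ⊗ c i` into `f ⊗ 1`, which can
    -- then be cancelled.
    have h1 : (f : S) ⊗ₜ[k] (1 : H) * act.coaction s =
        act.coaction (f * s) * sumTmul c S (Finsupp.single (-i) 1) := by
      have h2 : c i * c (-i) = 1 := by rw [← hcadd, add_neg_cancel, hc0]
      rw [sumTmul_single, map_mul, hf', mul_right_comm, Algebra.TensorProduct.tmul_mul_tmul, h2,
        mul_one]
    have h3 : act.coaction s ∈ LinearMap.range (sumTmul (R := k) c S) := by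
      refine mem_range_sumTmul_of_tmul_one_mul_mem hli (f := (f : S))
        (fun h ↦ hf0 (Subtype.ext h)) ?_
      rw [h1]
      exact mul_mem_range_sumTmul hcadd (hA' _ hs) ⟨_, rfl⟩
    obtain ⟨x, hx⟩ := h3
    rw [← act.sum_eq_of_coaction_eq_sumTmul hc hx.symm]
    exact sum_mem fun j _ ↦ hA j _ (act.mem_weightSpace_of_coaction_eq_sumTmul hc hinj hx.symm j)
  · intro i f hf hf0 𝔭 h𝔭
    have : 𝔭.IsPrime := h𝔭.1.1
    -- The core is a prime containing `f`, so minimality of `𝔭` makes `𝔭` equal to its core.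
    have h1 : 𝔭 ≤ act.core 𝔭 := h𝔭.2 ⟨act.isPrime_core 𝔭,
      (act.isStable_span_of_mem_weightSpace hf).le_core act h𝔭.1.2⟩ (act.core_le 𝔭)
    have h2 : act.IsStable 𝔭 := le_antisymm (act.core_le 𝔭) h1 ▸ act.isStable_core 𝔭
    exact ⟨𝔭, le_rfl, fun _ _ _ hg ↦ hg, hprin 𝔭 this h2⟩

end Semiinvariants

end GroupSchemeAction

theorem mainTheorem7 :
    (∀ (R : Type u) [CommRing R] [IsNoetherianRing R]
      (HN HF HT : Type u) [CommRing HN] [HopfAlgebra R HN] [CommRing HF] [HopfAlgebra R HF]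
      [CommRing HT] [HopfAlgebra R HT]
      [Module.Flat R HN] [Algebra.FiniteType R HN]
      [Module.Flat R HF] [Algebra.FiniteType R HF]
      [Module.Flat R HT] [Algebra.FiniteType R HT]
      (φ : HF →ₐc[R] HN) (ψ : HT →ₐc[R] HF),
      IsShortExactGroupSchemes φ ψ →
      ∀ n : ℕ, Nonempty (HT ≃ₐc[R] AddMonoidAlgebra R (Fin n → ℤ)) →
      ∀ (S : Type v) [CommRing S] [Algebra R S] [IsNoetherianRing S]
        (act : GroupSchemeAction R HF S),
        act.IsFDomain →
        (∀ P : Ideal S, act.IsFPrime P → P.height = 1 →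
          PrincipalContractionIfMinimal (act.restrict φ).invariants P) →
        IsDomain (act.restrict φ).invariants ∧
          UniqueFactorizationMonoid (act.restrict φ).invariants) ∧
    (∀ (k : Type u) [Field k] (HG : Type u) [CommRing HG] [HopfAlgebra k HG]
      [Algebra.Smooth k HG] [ConnectedSpace (PrimeSpectrum HG)]
      (S : Type v) [CommRing S] [Algebra k S] [IsNoetherianRing S] [IsDomain S]
      (act : GroupSchemeAction k HG S),
        (∀ P : Ideal S, P.IsPrime → act.IsStable P → P.height = 1 →
          PrincipalContractionIfMinimal act.semiinvariants P) →
        IsDomain act.semiinvariants ∧ UniqueFactorizationMonoid act.semiinvariants) := by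
  refine ⟨?_, ?_⟩
  · intro R _ _ HN HF HT _ _ _ _ _ _ _ _ _ _ _ _ φ ψ h n ⟨e⟩ S _ _ _ act hdom hprin
    exact GroupSchemeAction.isDomain_and_uniqueFactorizationMonoid_invariants h n e act hdom hprin
  · intro k _ HG _ _ _ _ S _ _ _ _ act hprin
    exact GroupSchemeAction.isDomain_and_uniqueFactorizationMonoid_semiinvariants act hprin
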